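/- Let $n\ge 3$ and $m>0$. Place unit masses at the vertices $q_k=(\cos\frac{2\pi k}{n},\sin\frac{2\pi k}{n})$, $1\le k\le n$, of a regular $n$-gon in $\mathbb{R}^2$ and a mass $m$ at its center $q_{n+1}=0$, and let $z_0=(q_1,\dots,q_{n+1})\in(\mathbb{R}^2)^{n+1}$. With masses $\mu_1=\dots=\mu_n=1$, $\mu_{n+1}=m$, put $$U(z)=\sum_{1\le i<j\le n+1}\frac{\mu_i\mu_j}{|z_i-z_j|},\qquad I(z)=\frac12\sum_{i=1}^{n+1}\mu_i|z_i|^2 .$$ A central configuration is a collision-free critical point of $\sqrt I\,U$; it is called (nontrivially) degenerate if the kernel of the Hessian of $\sqrt I\,U$ at it contains a vector outside the span of the two trivial directions, namely the infinitesimal dilation $z$ and the infinitesimal rotation $(Jz_1,\dots,Jz_{n+1})$, where $J(x,y)=(-y,x)$. A number $m^*>0$ is a degeneracy value for $n$ if, for $m=m^*$, the configuration $z_0$ is a degenerate central configuration. Theorem (Multiplicity of degeneracy values). The number $N(n)$ of distinct degeneracy values $m^*>0$ is finite and equals $$N(3)=1,\qquad N(n)=\Big\lfloor\frac n2\Big\rfloor-1\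 (4\le n\le 6),\qquad N(n)=\Big\lfloor\frac n2\Big\rfloor-2\ (7\le n\le 9),\qquad N(n)=\Big\lfloor\frac n2\Big\rfloor-1\ (n\ge 10).$$ In particular, for $n\ge7$ the number $N(n)$ increases with $n$, in the sense that $N(n)\le N(n+1)$ and $N(n)<N(n+2)$ for all $n\ge 7$. -/

import Mathlib

noncomputable section

/-- The Euclidean plane. -/
abbrev Plane : Type := EuclideanSpace ℝ (Fin 2)

/-- Positions of `N` bodies in the plane, i.e. points of `ℝ ^ (2 N)`. -/
abbrev Config (N : ℕ) : Type := Fin N → Plane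

/-- The Newtonian potential `U = ∑_{i < j} μ i μ j / |q i - q j|`. -/
def newtonPotential {N : ℕ} (μ : Fin N → ℝ) (q : Config N) : ℝ :=
  ∑ i : Fin N, ∑ j ∈ Finset.Ioi i, μ i * μ j / ‖q i - q j‖

/-- The moment of inertia `I = (1/2) ∑ μ i |q i|²`. -/
def momentOfInertia {N : ℕ} (μ : Fin N → ℝ) (q : Config N) : ℝ :=
  (1 / 2) * ∑ i : Fin N, μ i * ‖q i‖ ^ 2

/-- The function `√I · U` on configurations. -/
def sqrtInertiaPotential {N : ℕ} (μ : Fin N → ℝ) (q : Config N) : ℝ :=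
  √(momentOfInertia μ q) * newtonPotential μ q

/-- A collision-free configuration is central if it is a critical point of `√I · U`. -/
def IsCentralConfiguration {N : ℕ} (μ : Fin N → ℝ) (q : Config N) : Prop :=
  Function.Injective q ∧ HasFDerivAt (sqrtInertiaPotential μ) (0 : Config N →L[ℝ] ℝ) q

/-- The Hessian of `√I · U` at `q`, as a bilinear form
`ξ η ↦ D²(√I · U)(q)(ξ, η)` on the configuration space. -/
def hessian {N : ℕ} (μ : Fin N → ℝ) (q : Config N) : Config N →L[ℝ] Config N →L[ℝ] ℝ :=
  fderiv ℝ (fderiv ℝ (sqrtInertiaPotential μ)) q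

/-- Rotation of the plane by a right angle. -/
def quarterTurn (x : Plane) : Plane := !₂[-x 1, x 0]

/-- The directions along which `√I · U` is constant for trivial reasons: the span of the
infinitesimal dilation `q` and the infinitesimal rotation `(quarterTurn (q i))_i`. -/
def trivialDirections {N : ℕ} (q : Config N) : Submodule ℝ (Config N) :=
  Submodule.span ℝ {q, fun i => quarterTurn (q i)}

/-- A central configuration is (nontrivially) degenerate if the kernel of the Hessian of
`√I · U` contains a vector outside the trivial directions. -/
def IsDegenerate {N : ℕ} (μ : Fin N → ℝ) (q : Config N) : Prop :=
  IsCentralConfiguration μ q ∧ ∃ ξ : Config N, hessian μ q ξ = 0 ∧ ξ ∉ trivialDirections q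

/-- The central + regular `n`-gon configuration: the `n` vertices
`(cos (k θ), sin (k θ))`, `k = 1, …, n`, `θ = 2 π / n`, followed by the origin. -/
def centeredPolygon (n : ℕ) : Config (n + 1) :=
  Fin.snoc (α := fun _ => Plane)
    (fun k : Fin n =>
      !₂[Real.cos (((k : ℕ) + 1 : ℝ) * (2 * Real.pi / n)),
        Real.sin (((k : ℕ) + 1 : ℝ) * (2 * Real.pi / n))])
    0

/-- Unit masses at the vertices and mass `m` at the center. -/
def centeredPolygonMass (n : ℕ) (m : ℝ) : Fin (n + 1) → ℝ :=
  Fin.snoc (α := fun _ => ℝ) (fun _ : Fin n => (1 : ℝ)) m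

/-- The positive values of the central mass for which the central + regular `n`-gon
configuration is degenerate. -/
def degeneracyValues (n : ℕ) : Set ℝ :=
  {m : ℝ | 0 < m ∧ IsDegenerate (centeredPolygonMass n m) (centeredPolygon n)}

end

/-!
At a configuration on which the Newtonian forces are balanced, the kernel of the Hessian of `√I U`
is, up to multiples of the dilation, the kernel of a linear system in the displacements. Written in
complex coordinates that rotate with the vertices, this system commutes with the rotations of the
polygon, so the discrete Fourier transform decouples it: the modes `±l` with `2 ≤ l ≤ n / 2` form a
`2 × 2` system each, and the modes `±1` form a `3 × 3` system with the displacement of the center.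
All the determinants are affine in the central mass `m`. Those with `l ≥ 2` have roots that
increase strictly with `l`, so their positive roots are counted by locating the first one, which is
`l = 2` or `l = 3` according to the sign of the root at `l = 2`. The first mode is positive at
`m = 0` and contributes a further root exactly when its slope is negative, that is, for `n ≤ 6`.
These signs are read off rational enclosures for small `n`; for large `n` they follow from the
growth of the sum of the `1 / sin (π s / n)`, which exceeds `cot (π / (2 n))` by a logarithmic
factor.
-/

open scoped RealInnerProductSpace ComplexConjugate Topology

/-! ### The Hessian of `√I U` -/

section InnerProduct

variable {F : Type*} [NormedAddCommGroup F] [InnerProductSpace ℝ F]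

theorem hasFDerivAt_inv_norm {v : F} (hv : v ≠ 0) :
    HasFDerivAt (fun x : F => ‖x‖⁻¹) (-(‖v‖⁻¹ ^ 3) • innerSL ℝ v) v := by
  have hv' : ‖v‖ ≠ 0 := norm_ne_zero_iff.2 hv
  have hnorm : HasFDerivAt (fun x : F => ‖x‖) ((1 / (2 * ‖v‖)) • 2 • innerSL ℝ v) v := by
    simpa only [Real.sqrt_sq (norm_nonneg _)] using
      (hasStrictFDerivAt_norm_sq v).hasFDerivAt.sqrt (by positivity)
  refine ((hasDerivAt_inv hv').comp_hasFDerivAt v hnorm).congr_fderiv ?_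
  ext w
  simp only [one_div, mul_inv_rev, neg_smul, neg_apply, smul_apply, coe_innerSL_apply,
    nsmul_eq_mul, Nat.cast_ofNat, smul_eq_mul, inv_pow, neg_inj]
  field_simp

theorem sum_Ioi_inner_sub {ι : Type*} [Fintype ι] [LinearOrder ι] [LocallyFiniteOrderTop ι]
    [LocallyFiniteOrderBot ι] {v : ι → ι → F} (hv : ∀ i j, v j i = -v i j) (η : ι → F) :
    ∑ i, ∑ j ∈ Finset.Ioi i, ⟪v i j, η i - η j⟫ = ∑ i, ⟪∑ j, v i j, η i⟫ := by
  have : IsAddTorsionFree F := .of_isTorsionFree ℝ F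
  have hdiag (i : ι) : v i i = 0 := self_eq_neg.1 (hv i i)
  calc ∑ i, ∑ j ∈ Finset.Ioi i, ⟪v i j, η i - η j⟫
      = ∑ i, ∑ j ∈ Finset.Ioi i, (⟪v i j, η i⟫ + ⟪v j i, η j⟫) := by
        refine Finset.sum_congr rfl fun i _ => Finset.sum_congr rfl fun j _ => ?_
        rw [hv i j, inner_neg_left, inner_sub_right, sub_eq_add_neg]
    _ = ∑ i, ∑ j ∈ {i}ᶜ, ⟪v i j, η i⟫ :=
        Finset.sum_sum_Ioi_add_eq_sum_sum_off_diag fun j i => ⟪v i j, η i⟫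
    _ = ∑ i, ⟪∑ j, v i j, η i⟫ := by
        refine Finset.sum_congr rfl fun i _ => ?_
        rw [sum_inner, Fintype.sum_eq_add_sum_compl i, hdiag, inner_zero_left, zero_add]

end InnerProduct

/-- The differential of the Newtonian potential at `q`. -/
noncomputable def potentialDeriv {N : ℕ} (μ : Fin N → ℝ) (q : Config N) : Config N →L[ℝ] ℝ :=
  ∑ i, ∑ j ∈ Finset.Ioi i, (μ i * μ j) •
    ((-(‖q i - q j‖⁻¹ ^ 3) • innerSL ℝ (q i - q j)) ∘L
      (ContinuousLinearMap.proj (R := ℝ) (φ := fun _ => Plane) i - ContinuousLinearMap.proj j))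

/-- The mass inner product `∑ μ i ⟨q i, η i⟩`; as a functional of `η` it is the differential of the
moment of inertia at `q`. -/
noncomputable def massInner {N : ℕ} (μ : Fin N → ℝ) (q : Config N) : Config N →L[ℝ] ℝ :=
  ∑ i, μ i • (innerSL ℝ (q i) ∘L ContinuousLinearMap.proj (R := ℝ) (φ := fun _ => Plane) i)

/-- The second differential of the Newtonian potential at `q`, as a function of two directions. -/
noncomputable def potentialHess {N : ℕ} (μ : Fin N → ℝ) (q ξ η : Config N) : ℝ :=
  ∑ i, ∑ j ∈ Finset.Ioi i, μ i * μ j *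
    (3 * ‖q i - q j‖⁻¹ ^ 5 * ⟪q i - q j, ξ i - ξ j⟫ * ⟪q i - q j, η i - η j⟫
      - ‖q i - q j‖⁻¹ ^ 3 * ⟪ξ i - ξ j, η i - η j⟫)

/-- A configuration is balanced with multiplier `c` if `dU = -c dI`. For `I ≠ 0` this is the usual
equation of central configurations. -/
def IsBalanced {N : ℕ} (μ : Fin N → ℝ) (q : Config N) (c : ℝ) : Prop :=
  ∀ η, potentialDeriv μ q η = -c * massInner μ q η

section Hessian

variable {N : ℕ} {μ : Fin N → ℝ} {q ξ η : Config N} {c : ℝ}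

theorem potentialDeriv_apply : potentialDeriv μ q η =
    ∑ i, ∑ j ∈ Finset.Ioi i, μ i * μ j * (-(‖q i - q j‖⁻¹ ^ 3) * ⟪q i - q j, η i - η j⟫) := by
  simp only [potentialDeriv, sum_apply, smul_apply, ContinuousLinearMap.comp_apply, sub_apply,
    ContinuousLinearMap.proj_apply, innerSL_apply_apply, smul_eq_mul]

theorem massInner_apply : massInner μ q η = ∑ i, μ i * ⟪q i, η i⟫ := by
  simp [massInner, sum_apply]

theorem massInner_self : massInner μ q q = 2 * momentOfInertia μ q := by
  simp [massInner_apply, momentOfInertia]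

theorem massInner_comm : massInner μ q η = massInner μ η q := by
  simp only [massInner_apply, real_inner_comm]

theorem massInner_add_smul_left (t : ℝ) :
    massInner μ (q + t • ξ) η = massInner μ q η + t * massInner μ ξ η := by
  rw [massInner_comm, map_add, map_smul, massInner_comm, massInner_comm (q := η), smul_eq_mul]

theorem sub_ne_zero_of_mem_Ioi (hq : Function.Injective q) {i j : Fin N}
    (hj : j ∈ Finset.Ioi i) : q i - q j ≠ 0 :=
  sub_ne_zero.2 (hq.ne (Finset.mem_Ioi.1 hj).ne)

theorem hasFDerivAt_newtonPotential (hq : Function.Injective q) :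
    HasFDerivAt (newtonPotential μ) (potentialDeriv μ q) q := by
  unfold newtonPotential potentialDeriv
  simp only [div_eq_mul_inv]
  refine HasFDerivAt.fun_sum fun i _ => HasFDerivAt.fun_sum fun j hj => HasFDerivAt.const_mul ?_ _
  exact (hasFDerivAt_inv_norm (sub_ne_zero_of_mem_Ioi hq hj)).comp q
    (f := fun q : Config N => q i - q j) ((hasFDerivAt_apply i q).sub (hasFDerivAt_apply j q))

theorem hasFDerivAt_momentOfInertia : HasFDerivAt (momentOfInertia μ) (massInner μ q) q := by
  have hsum : HasFDerivAt (fun q : Config N => ∑ i, μ i * ‖q i‖ ^ 2) _ q :=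
    HasFDerivAt.fun_sum fun i _ => (hasFDerivAt_apply i q).norm_sq.const_mul (μ i)
  refine (hsum.const_mul (1 / 2 : ℝ)).congr_fderiv ?_
  ext1 v
  simp only [massInner_apply, sum_apply, smul_apply, smul_eq_mul, Finset.mul_sum,
    ContinuousLinearMap.comp_apply, ContinuousLinearMap.proj_apply, innerSL_apply_apply,
    nsmul_eq_mul]
  refine Finset.sum_congr rfl fun i _ => ?_
  push_cast
  ring

theorem hasFDerivAt_sqrtInertiaPotential (hq : Function.Injective q)
    (hI : momentOfInertia μ q ≠ 0) :
    HasFDerivAt (sqrtInertiaPotential μ)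
      (√(momentOfInertia μ q) • potentialDeriv μ q + newtonPotential μ q •
        ((1 / (2 * √(momentOfInertia μ q))) • massInner μ q)) q :=
  (hasFDerivAt_momentOfInertia.sqrt hI).mul (hasFDerivAt_newtonPotential hq)

theorem contDiffAt_sqrtInertiaPotential (hq : Function.Injective q)
    (hI : momentOfInertia μ q ≠ 0) : ContDiffAt ℝ 2 (sqrtInertiaPotential μ) q := by
  have hproj (i : Fin N) : ContDiffAt ℝ 2 (fun q : Config N => q i) q :=
    (contDiff_apply ℝ Plane i).contDiffAt
  have hinertia : ContDiffAt ℝ 2 (momentOfInertia μ) q :=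
    contDiffAt_const.mul (ContDiffAt.sum fun i _ => contDiffAt_const.mul ((hproj i).norm_sq ℝ))
  refine (hinertia.sqrt hI).mul (ContDiffAt.sum fun i _ => ContDiffAt.sum fun j hj => ?_)
  have hd := sub_ne_zero_of_mem_Ioi hq hj
  exact contDiffAt_const.div (((hproj i).sub (hproj j)).norm ℝ hd) (norm_ne_zero_iff.2 hd)

theorem eventually_injective {ι X : Type*} [Finite ι] [TopologicalSpace X] [T2Space X]
    {f : ι → X} (hf : Function.Injective f) : ∀ᶠ g in 𝓝 f, Function.Injective g := by
  have hne (i j : ι) : ∀ᶠ g in 𝓝 f, g i = g j → i = j := by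
    by_cases hij : i = j
    · exact .of_forall fun _ _ => hij
    · have hopen : IsOpen {g : ι → X | g i ≠ g j} :=
        isOpen_ne_fun (continuous_apply i) (continuous_apply j)
      filter_upwards [hopen.mem_nhds (hf.ne hij)] with g hg h using absurd h hg
  filter_upwards [Filter.eventually_all.2 fun i => Filter.eventually_all.2 (hne i)] with g hg i j
    using hg i j

theorem hasLineDerivAt_potentialDeriv (hq : Function.Injective q) :
    HasLineDerivAt ℝ (potentialDeriv μ · η) (potentialHess μ q ξ η) q ξ := by
  simp only [potentialDeriv_apply, potentialHess]
  refine HasDerivAt.fun_sum fun i _ => HasDerivAt.fun_sum fun j hj => HasDerivAt.const_mul _ ?_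
  have hrel := (hasFDerivAt_apply (𝕜 := ℝ) i q).fun_sub (hasFDerivAt_apply j q)
  have hnorm : HasLineDerivAt ℝ (fun p : Config N => ‖p i - p j‖⁻¹) _ q ξ :=
    (HasFDerivAt.comp (g := fun v : Plane => ‖v‖⁻¹) q
      (hasFDerivAt_inv_norm (sub_ne_zero_of_mem_Ioi hq hj)) hrel).hasLineDerivAt ξ
  have hinner : HasLineDerivAt ℝ (fun p : Config N => ⟪p i - p j, η i - η j⟫) _ q ξ :=
    (hrel.inner ℝ (hasFDerivAt_const (η i - η j) q)).hasLineDerivAt ξ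
  refine ((HasDerivAt.fun_pow hnorm 3).fun_neg.mul hinner).congr_deriv ?_
  simp only [Nat.cast_ofNat, zero_smul, Pi.add_apply, Pi.zero_apply, add_zero,
    Nat.add_one_sub_one, inv_pow, neg_smul, ContinuousLinearMap.comp_sub,
    ContinuousLinearMap.neg_comp, ContinuousLinearMap.smul_comp, sub_neg_eq_add, add_apply,
    neg_apply, smul_apply, ContinuousLinearMap.comp_apply, ContinuousLinearMap.proj_apply,
    coe_innerSL_apply, smul_eq_mul, inner_sub_right (q i - q j), neg_mul,
    ContinuousLinearMap.prod_apply, sub_apply, zero_apply, fderivInnerCLM_apply,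
    inner_zero_right, zero_add]
  ring

theorem hasLineDerivAt_fderiv_sqrtInertiaPotential (hq : Function.Injective q)
    (hI : momentOfInertia μ q ≠ 0) :
    HasLineDerivAt ℝ (fun p => fderiv ℝ (sqrtInertiaPotential μ) p η) (hessian μ q ξ η) q ξ := by
  have hd : DifferentiableAt ℝ (fderiv ℝ (sqrtInertiaPotential μ)) q :=
    ((contDiffAt_sqrtInertiaPotential hq hI).fderiv_right
      (m := 1) (by norm_num)).differentiableAt one_ne_zero
  exact ((ContinuousLinearMap.apply ℝ ℝ η).hasFDerivAt.comp q hd.hasFDerivAt).hasLineDerivAt ξ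

theorem fderiv_sqrtInertiaPotential_eventuallyEq (hq : Function.Injective q)
    (hI : momentOfInertia μ q ≠ 0) :
    (fun p => fderiv ℝ (sqrtInertiaPotential μ) p η) =ᶠ[𝓝 q] fun p =>
      √(momentOfInertia μ p) * potentialDeriv μ p η +
        newtonPotential μ p * ((2 * √(momentOfInertia μ p))⁻¹ * massInner μ p η) := by
  filter_upwards [eventually_injective hq,
    hasFDerivAt_momentOfInertia.continuousAt.eventually_ne hI] with p hp hIp
  simp [(hasFDerivAt_sqrtInertiaPotential hp hIp).fderiv]

theorem hessian_apply (hq : Function.Injective q) (hI : 0 < momentOfInertia μ q) :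
    hessian μ q ξ η = √(momentOfInertia μ q) * potentialHess μ q ξ η
      + (1 / (2 * √(momentOfInertia μ q))) *
        (massInner μ q ξ * potentialDeriv μ q η + potentialDeriv μ q ξ * massInner μ q η
          + newtonPotential μ q * massInner μ ξ η)
      - newtonPotential μ q * massInner μ q ξ * massInner μ q η /
        (4 * √(momentOfInertia μ q) ^ 3) := by
  have hs : √(momentOfInertia μ q) ≠ 0 := (Real.sqrt_pos.2 hI).ne'
  have hsqrt : HasLineDerivAt ℝ (fun p => √(momentOfInertia μ p)) _ q ξ :=
    (hasFDerivAt_momentOfInertia.sqrt hI.ne').hasLineDerivAt ξ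
  have hU := (hasFDerivAt_newtonPotential (μ := μ) hq).hasLineDerivAt ξ
  have hdI : HasLineDerivAt ℝ (fun p => massInner μ p η) (massInner μ ξ η) q ξ := by
    simp only [HasLineDerivAt, massInner_add_smul_left]
    simpa using ((hasDerivAt_id (0 : ℝ)).mul_const (massInner μ ξ η)).const_add (massInner μ q η)
  have hderiv : HasLineDerivAt ℝ (fun p => √(momentOfInertia μ p) * potentialDeriv μ p η +
      newtonPotential μ p * ((2 * √(momentOfInertia μ p))⁻¹ * massInner μ p η)) _ q ξ :=
    (HasDerivAt.fun_mul hsqrt (hasLineDerivAt_potentialDeriv (μ := μ) (η := η) hq)).fun_add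
      (HasDerivAt.fun_mul hU
        (((HasDerivAt.const_mul 2 hsqrt).fun_inv (by simpa using hs)).fun_mul hdI))
  rw [(hasLineDerivAt_fderiv_sqrtInertiaPotential hq hI.ne').unique
    (hderiv.congr_of_eventuallyEq (fderiv_sqrtInertiaPotential_eventuallyEq hq hI.ne'))]
  simp only [zero_smul, add_zero, smul_apply, smul_eq_mul]
  field_simp
  ring

theorem potentialDeriv_self (hq : Function.Injective q) :
    potentialDeriv μ q q = -newtonPotential μ q := by
  simp only [potentialDeriv_apply, newtonPotential, ← Finset.sum_neg_distrib]
  refine Finset.sum_congr rfl fun i _ => Finset.sum_congr rfl fun j hj => ?_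
  have hd := norm_ne_zero_iff.2 (sub_ne_zero_of_mem_Ioi hq hj)
  rw [real_inner_self_eq_norm_sq]
  field_simp

theorem potentialHess_self (hq : Function.Injective q) :
    potentialHess μ q q η = -2 * potentialDeriv μ q η := by
  simp only [potentialDeriv_apply, potentialHess, Finset.mul_sum]
  refine Finset.sum_congr rfl fun i _ => Finset.sum_congr rfl fun j hj => ?_
  have hd := norm_ne_zero_iff.2 (sub_ne_zero_of_mem_Ioi hq hj)
  rw [real_inner_self_eq_norm_sq]
  field_simp
  ring

theorem potentialHess_comm : potentialHess μ q ξ η = potentialHess μ q η ξ := by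
  simp only [potentialHess]
  refine Finset.sum_congr rfl fun i _ => Finset.sum_congr rfl fun j _ => ?_
  rw [real_inner_comm (ξ i - ξ j) (η i - η j)]
  ring

theorem potentialHess_add_smul_left (t : ℝ) (ζ : Config N) :
    potentialHess μ q (ξ + t • ζ) η = potentialHess μ q ξ η + t * potentialHess μ q ζ η := by
  simp only [potentialHess, Finset.mul_sum, ← Finset.sum_add_distrib]
  refine Finset.sum_congr rfl fun i _ => Finset.sum_congr rfl fun j _ => ?_
  have hrel : (ξ + t • ζ) i - (ξ + t • ζ) j = (ξ i - ξ j) + t • (ζ i - ζ j) := by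
    simp only [Pi.add_apply, Pi.smul_apply]
    module
  rw [hrel]
  simp only [inner_add_left, inner_add_right, real_inner_smul_left, real_inner_smul_right]
  ring

namespace IsBalanced

theorem newtonPotential_eq (hb : IsBalanced μ q c) (hq : Function.Injective q) :
    newtonPotential μ q = 2 * c * momentOfInertia μ q := by
  have h := hb q
  rw [potentialDeriv_self hq, massInner_self] at h
  linarith

theorem isCentralConfiguration (hb : IsBalanced μ q c)
    (hq : Function.Injective q) (hI : 0 < momentOfInertia μ q) : IsCentralConfiguration μ q := by
  refine ⟨hq, (hasFDerivAt_sqrtInertiaPotential hq hI.ne').congr_fderiv ?_⟩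
  ext1 η
  have : 0 < √(momentOfInertia μ q) := Real.sqrt_pos.2 hI
  simp only [add_apply, smul_apply, smul_eq_mul, zero_apply, hb η, hb.newtonPotential_eq hq]
  nth_rw 2 [← Real.sq_sqrt hI.le]
  field_simp
  ring

theorem potentialHess_self (hb : IsBalanced μ q c) (hq : Function.Injective q) (η : Config N) :
    potentialHess μ q q η = 2 * c * massInner μ q η := by
  rw [_root_.potentialHess_self hq, hb η]
  ring

theorem hessian_apply (hb : IsBalanced μ q c) (hq : Function.Injective q)
    (hI : 0 < momentOfInertia μ q) :
    hessian μ q ξ η = √(momentOfInertia μ q) * (potentialHess μ q ξ η + c * massInner μ ξ η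
      - 3 * c / (2 * momentOfInertia μ q) * massInner μ q ξ * massInner μ q η) := by
  have hs := Real.sqrt_pos.2 hI
  rw [_root_.hessian_apply hq hI, hb ξ, hb η, hb.newtonPotential_eq hq]
  have hsq : momentOfInertia μ q = √(momentOfInertia μ q) ^ 2 := (Real.sq_sqrt hI.le).symm
  generalize √(momentOfInertia μ q) = s at *
  rw [hsq]
  field_simp
  ring

theorem massInner_eq_zero (hb : IsBalanced μ q c) (hc : c ≠ 0) (hq : Function.Injective q)
    (hξ : potentialHess μ q ξ q + c * massInner μ ξ q = 0) : massInner μ q ξ = 0 := by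
  rw [potentialHess_comm, hb.potentialHess_self hq, massInner_comm (q := ξ)] at hξ
  have h3 : 3 * c * massInner μ q ξ = 0 := by linarith
  exact (mul_eq_zero.1 h3).resolve_left (by simpa using hc)

theorem isDegenerate_iff (hb : IsBalanced μ q c) (hc : c ≠ 0)
    (hq : Function.Injective q) (hI : 0 < momentOfInertia μ q) :
    IsDegenerate μ q ↔ ∃ ξ, (∀ η, potentialHess μ q ξ η + c * massInner μ ξ η = 0) ∧
      ξ ∉ trivialDirections q := by
  have hqm : q ∈ trivialDirections q := Submodule.subset_span (by simp)
  constructor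
  · -- Moving the kernel vector along `q` removes the rank-one term of the Hessian.
    rintro ⟨-, ξ, hξ0, hξ⟩
    set t := -(massInner μ q ξ / (2 * momentOfInertia μ q)) with ht
    refine ⟨ξ + t • q, fun η => ?_, ?_⟩
    · have hker : hessian μ q ξ η = 0 := by rw [hξ0, zero_apply]
      rw [hb.hessian_apply hq hI] at hker
      have hbracket := (mul_eq_zero.1 hker).resolve_left (Real.sqrt_pos.2 hI).ne'
      rw [potentialHess_add_smul_left, massInner_add_smul_left, hb.potentialHess_self hq,
        ← hbracket, ht]
      ring
    · rwa [Submodule.add_mem_iff_left _ (Submodule.smul_mem _ t hqm)]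
  · rintro ⟨ξ, hξ0, hξ⟩
    refine ⟨hb.isCentralConfiguration hq hI, ξ, ?_, hξ⟩
    ext1 η
    simp [hb.hessian_apply hq hI, hξ0, hb.massInner_eq_zero hc hq (hξ0 q)]

end IsBalanced

theorem isBalanced_of_forall
    (h : ∀ i, ∑ j, (μ j * ‖q i - q j‖⁻¹ ^ 3) • (q i - q j) = c • q i) : IsBalanced μ q c := by
  intro η
  have hanti (i j : Fin N) : (-(μ j * μ i * ‖q j - q i‖⁻¹ ^ 3)) • (q j - q i) =
      -((-(μ i * μ j * ‖q i - q j‖⁻¹ ^ 3)) • (q i - q j)) := by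
    rw [norm_sub_rev (q j)]
    module
  have hforce (i : Fin N) : ∑ j, (-(μ i * μ j * ‖q i - q j‖⁻¹ ^ 3)) • (q i - q j) =
      (-(μ i * c)) • q i := by
    rw [neg_smul, mul_smul, ← h i, Finset.smul_sum, ← Finset.sum_neg_distrib]
    exact Finset.sum_congr rfl fun j _ => by module
  calc potentialDeriv μ q η
      = ∑ i, ∑ j ∈ Finset.Ioi i,
          ⟪(-(μ i * μ j * ‖q i - q j‖⁻¹ ^ 3)) • (q i - q j), η i - η j⟫ := by
        simp only [potentialDeriv_apply, real_inner_smul_left, neg_mul, mul_neg, mul_assoc]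
    _ = ∑ i, ⟪(-(μ i * c)) • q i, η i⟫ := by simp only [sum_Ioi_inner_sub hanti, hforce]
    _ = -c * massInner μ q η := by
        rw [massInner_apply, Finset.mul_sum]
        exact Finset.sum_congr rfl fun i _ => by rw [real_inner_smul_left]; ring

theorem potentialHess_eq_sum_inner : potentialHess μ q ξ η =
    ∑ i, μ i * ⟪∑ j, μ j • ((3 * ‖q i - q j‖⁻¹ ^ 5 * ⟪q i - q j, ξ i - ξ j⟫) • (q i - q j)
      - ‖q i - q j‖⁻¹ ^ 3 • (ξ i - ξ j)), η i⟫ := by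
  set v : Fin N → Fin N → Plane := fun i j =>
    (μ i * μ j) • ((3 * ‖q i - q j‖⁻¹ ^ 5 * ⟪q i - q j, ξ i - ξ j⟫) • (q i - q j)
      - ‖q i - q j‖⁻¹ ^ 3 • (ξ i - ξ j)) with hv
  have hanti (i j : Fin N) : v j i = -v i j := by
    simp only [hv]
    rw [norm_sub_rev (q j), ← neg_sub (q i), ← neg_sub (ξ i), inner_neg_neg]
    module
  calc potentialHess μ q ξ η
      = ∑ i, ∑ j ∈ Finset.Ioi i, ⟪v i j, η i - η j⟫ := by
        simp only [potentialHess, hv, real_inner_smul_left, inner_sub_left (_ • _ : Plane)]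
    _ = ∑ i, ⟪∑ j, v i j, η i⟫ := sum_Ioi_inner_sub hanti η
    _ = _ := by simp only [hv, mul_smul, ← Finset.smul_sum, real_inner_smul_left]

theorem forall_potentialHess_eq_zero_iff (hμ : ∀ i, μ i ≠ 0) :
    (∀ η, potentialHess μ q ξ η + c * massInner μ ξ η = 0) ↔
      ∀ i, ∑ j, μ j • ((3 * ‖q i - q j‖⁻¹ ^ 5 * ⟪q i - q j, ξ i - ξ j⟫) • (q i - q j)
        - ‖q i - q j‖⁻¹ ^ 3 • (ξ i - ξ j)) + c • ξ i = 0 := by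
  set f : Config N := fun i =>
    ∑ j, μ j • ((3 * ‖q i - q j‖⁻¹ ^ 5 * ⟪q i - q j, ξ i - ξ j⟫) • (q i - q j)
      - ‖q i - q j‖⁻¹ ^ 3 • (ξ i - ξ j)) + c • ξ i
  have hform (η : Config N) : potentialHess μ q ξ η + c * massInner μ ξ η =
      ∑ i, μ i * ⟪f i, η i⟫ := by
    rw [potentialHess_eq_sum_inner, massInner_apply, Finset.mul_sum, ← Finset.sum_add_distrib]
    refine Finset.sum_congr rfl fun i _ => ?_
    rw [inner_add_left, real_inner_smul_left (ξ i)]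
    ring
  simp only [hform]
  constructor
  · intro h i
    have hi := h (Pi.single i (f i))
    rw [Finset.sum_eq_single i (fun j _ hj => by simp [Pi.single_eq_of_ne hj]) (by simp),
      Pi.single_eq_same] at hi
    exact inner_self_eq_zero.1 ((mul_eq_zero.1 hi).resolve_left (hμ i))
  · intro h η
    exact Finset.sum_eq_zero fun i _ => by rw [show f i = 0 from h i, inner_zero_left, mul_zero]

end Hessian

/-! ### Complex coordinates -/

/-- The plane as the complex numbers. -/
noncomputable def planeC : Plane ≃ₗᵢ[ℝ] ℂ := Complex.orthonormalBasisOneI.repr.symm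

/-- The linearised attraction between two particles at relative position `d`, in the relative
direction `δ`. -/
noncomputable def tidal (d δ : ℂ) : ℂ :=
  1 / 2 * (‖d‖⁻¹ ^ 3 : ℝ) * δ + 3 / 2 * (‖d‖⁻¹ ^ 5 : ℝ) * d ^ 2 * conj δ

theorem planeC_apply (x : Plane) : planeC x = x 0 + x 1 * Complex.I :=
  Complex.orthonormalBasisOneI_repr_symm_apply x

theorem planeC_quarterTurn (x : Plane) : planeC (quarterTurn x) = Complex.I * planeC x := by
  simp only [planeC_apply, quarterTurn]
  apply Complex.ext <;> simp

theorem planeC_tidal (d δ : Plane) :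
    planeC ((3 * ‖d‖⁻¹ ^ 5 * ⟪d, δ⟫) • d - ‖d‖⁻¹ ^ 3 • δ) = tidal (planeC d) (planeC δ) := by
  rw [map_sub, map_smul, map_smul, tidal, ← planeC.norm_map d, ← planeC.inner_map_map d δ]
  generalize planeC d = d
  generalize planeC δ = δ
  rcases eq_or_ne d 0 with rfl | hd
  · simp
  have hnorm : (‖d‖ : ℂ) ≠ 0 := by simpa using hd
  have hinner : (⟪d, δ⟫ : ℂ) = (conj d * δ + d * conj δ) / 2 := by
    rw [Complex.inner, Complex.re_eq_add_conj]
    simp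
    ring
  simp only [Complex.real_smul]
  push_cast
  rw [hinner]
  field_simp
  linear_combination (3 * δ) * Complex.mul_conj' d

section ComplexCoordinates

variable {N : ℕ} {μ : Fin N → ℝ} {q ξ : Config N} {c : ℝ}

theorem mem_trivialDirections_iff :
    ξ ∈ trivialDirections q ↔ ∃ t : ℂ, ∀ i, planeC (ξ i) = t * planeC (q i) := by
  rw [trivialDirections, Submodule.mem_span_pair]
  constructor
  · rintro ⟨a, b, rfl⟩
    refine ⟨a + b * Complex.I, fun i => ?_⟩
    simp only [Pi.add_apply, Pi.smul_apply, map_add, map_smul, planeC_quarterTurn,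
      Complex.real_smul]
    ring
  · rintro ⟨t, ht⟩
    refine ⟨t.re, t.im, funext fun i => planeC.injective ?_⟩
    rw [ht]
    simp only [Pi.add_apply, Pi.smul_apply, map_add, map_smul, planeC_quarterTurn,
      Complex.real_smul]
    linear_combination planeC (q i) * Complex.re_add_im t

theorem isBalanced_of_planeC
    (h : ∀ i, ∑ j, (μ j : ℂ) * (‖planeC (q i) - planeC (q j)‖⁻¹ ^ 3 : ℝ) *
      (planeC (q i) - planeC (q j)) = c * planeC (q i)) : IsBalanced μ q c := by
  refine isBalanced_of_forall fun i => planeC.injective ?_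
  rw [map_smul, Complex.real_smul, ← h i, map_sum]
  refine Finset.sum_congr rfl fun j _ => ?_
  rw [map_smul, Complex.real_smul, ← map_sub, planeC.norm_map]
  push_cast
  ring

theorem forall_potentialHess_eq_zero_iff_tidal (hμ : ∀ i, μ i ≠ 0) :
    (∀ η, potentialHess μ q ξ η + c * massInner μ ξ η = 0) ↔
      ∀ i, ∑ j, (μ j : ℂ) * tidal (planeC (q i) - planeC (q j)) (planeC (ξ i) - planeC (ξ j)) +
        c * planeC (ξ i) = 0 := by
  rw [forall_potentialHess_eq_zero_iff hμ]
  refine forall_congr' fun i => ?_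
  rw [← planeC.map_eq_zero_iff, map_add, map_sum, map_smul, Complex.real_smul]
  simp only [← map_sub, ← planeC_tidal, map_smul, Complex.real_smul]

theorem isDegenerate_iff_tidal (hc : c ≠ 0) (hμ : ∀ i, μ i ≠ 0)
    (hq : Function.Injective q) (hI : 0 < momentOfInertia μ q) {z : Fin N → ℂ}
    (hz : ∀ i, planeC (q i) = z i)
    (h : ∀ i, ∑ j, (μ j : ℂ) * (‖z i - z j‖⁻¹ ^ 3 : ℝ) * (z i - z j) = c * z i) :
    IsDegenerate μ q ↔ ∃ w : Fin N → ℂ,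
      (∀ i, ∑ j, (μ j : ℂ) * tidal (z i - z j) (w i - w j) + c * w i = 0) ∧
      ¬ ∃ t : ℂ, ∀ i, w i = t * z i := by
  obtain rfl : (fun i => planeC (q i)) = z := funext hz
  rw [(isBalanced_of_planeC h).isDegenerate_iff hc hq hI]
  simp only [forall_potentialHess_eq_zero_iff_tidal hμ, mem_trivialDirections_iff]
  constructor
  · rintro ⟨ξ, hker, htriv⟩
    exact ⟨fun i => planeC (ξ i), hker, htriv⟩
  · rintro ⟨w, hker, htriv⟩
    exact ⟨fun i => planeC.symm (w i), by simpa using hker, by simpa using htriv⟩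

end ComplexCoordinates

/-! ### The regular polygon as `ZMod n` -/

open ZMod (stdAddChar)

theorem tidal_mul_mul {a : ℂ} (ha : ‖a‖ = 1) (d δ : ℂ) :
    tidal (a * d) (a * δ) = a * tidal d δ := by
  have hconj : a * conj a = 1 := by rw [Complex.mul_conj', ha]; simp
  rw [tidal, tidal, norm_mul, ha, one_mul, map_mul]
  linear_combination 3 / 2 * (‖d‖⁻¹ ^ 5 : ℝ) * d ^ 2 * conj δ * a * hconj

theorem tidal_neg_neg (d δ : ℂ) : tidal (-d) (-δ) = -tidal d δ := by
  simpa using tidal_mul_mul (a := -1) (by simp) d δ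

theorem tidal_one (δ : ℂ) : tidal 1 δ = 1 / 2 * δ + 3 / 2 * conj δ := by
  simp [tidal]

theorem tidal_one_sub {a : ℂ} (ha : ‖a‖ = 1) (x y : ℂ) :
    tidal (1 - a) (x - a * y) =
      (‖1 - a‖⁻¹ ^ 3 : ℝ) * (1 / 2 * (x - a * y) + 3 / 2 * (conj y - a * conj x)) := by
  rcases eq_or_ne (1 - a) 0 with h | h
  · simp [tidal, h]
  have hconj : a * conj a = 1 := by rw [Complex.mul_conj', ha]; simp
  have hsq : (1 - a) ^ 2 = -a * (‖1 - a‖ : ℂ) ^ 2 := by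
    rw [← Complex.mul_conj', map_sub, map_one]
    linear_combination (a - 1) * hconj
  have hpow : (‖1 - a‖ : ℂ)⁻¹ ^ 5 * (‖1 - a‖ : ℂ) ^ 2 = (‖1 - a‖ : ℂ)⁻¹ ^ 3 := by
    have : (‖1 - a‖ : ℂ) ≠ 0 := by simpa using h
    field_simp
  rw [tidal, hsq, map_sub, map_mul]
  push_cast
  linear_combination 3 / 2 * (conj y - a * conj x) * hpow +
    3 / 2 * (‖1 - a‖ : ℂ)⁻¹ ^ 5 * (‖1 - a‖ : ℂ) ^ 2 * conj y * hconj

theorem natCast_zmod_ne_zero {n l : ℕ} (h0 : 0 < l) (hl : l < n) : (l : ZMod n) ≠ 0 := by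
  rw [Ne, ZMod.natCast_eq_zero_iff]
  exact Nat.not_dvd_of_pos_of_lt h0 hl

theorem one_ne_zero_zmod {n : ℕ} (hn : 2 ≤ n) : (1 : ZMod n) ≠ 0 :=
  mod_cast natCast_zmod_ne_zero one_pos hn

theorem two_ne_zero_zmod {n : ℕ} (hn : 3 ≤ n) : (2 : ZMod n) ≠ 0 :=
  mod_cast natCast_zmod_ne_zero two_pos hn

theorem one_ne_neg_one_zmod {n : ℕ} (hn : 3 ≤ n) : (1 : ZMod n) ≠ -1 := fun h =>
  two_ne_zero_zmod hn (by linear_combination h)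

theorem centeredPolygonMass_ne_zero {n : ℕ} {m : ℝ} (hm : m ≠ 0) (i : Fin (n + 1)) :
    centeredPolygonMass n m i ≠ 0 := by
  refine Fin.lastCases ?_ (fun k => ?_) i <;> simp [centeredPolygonMass, hm]

section RegularPolygon

variable {n : ℕ} [NeZero n]

theorem conj_stdAddChar (j : ZMod n) : conj (stdAddChar j) = stdAddChar (-j) :=
  (AddChar.map_neg_eq_conj _ j).symm

theorem stdAddChar_ne_zero (j : ZMod n) : stdAddChar j ≠ (0 : ℂ) := fun h => by
  simpa [h] using AddChar.norm_apply stdAddChar j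

theorem stdAddChar_mul_neg (j : ZMod n) : stdAddChar j * stdAddChar (-j) = (1 : ℂ) := by
  rw [← AddChar.map_add_eq_mul, add_neg_cancel, AddChar.map_zero_eq_one]

theorem stdAddChar_sub_stdAddChar_add (j s : ZMod n) :
    stdAddChar j - stdAddChar (j + s) = stdAddChar j * (1 - stdAddChar s) := by
  rw [AddChar.map_add_eq_mul]
  ring

theorem re_stdAddChar_le_one (j : ZMod n) : (stdAddChar j).re ≤ 1 :=
  (Complex.re_le_norm _).trans (AddChar.norm_apply stdAddChar j).le

theorem sum_stdAddChar_mul (l : ZMod n) :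
    ∑ j, stdAddChar (l * j) = if l = 0 then (n : ℂ) else 0 := by
  simpa [mul_comm, ZMod.card] using AddChar.sum_mulShift l (ZMod.isPrimitive_stdAddChar n)

theorem sum_stdAddChar_of_two_le (hn : 2 ≤ n) : ∑ j : ZMod n, stdAddChar j = (0 : ℂ) := by
  simpa [one_ne_zero_zmod hn] using sum_stdAddChar_mul (1 : ZMod n)

/-- The inverse cube of the distance between vertices `s` steps apart in the regular `n`-gon. -/
noncomputable def chordWeight (s : ZMod n) : ℝ := ‖(1 : ℂ) - stdAddChar s‖⁻¹ ^ 3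

theorem chordWeight_neg (s : ZMod n) : chordWeight (-s) = chordWeight s := by
  rw [chordWeight, chordWeight, ← conj_stdAddChar, ← RCLike.norm_conj]
  simp

/-- The eigenvalue, on the `l`-th Fourier mode, of the Laplacian of the vertices of the `n`-gon
weighted by inverse cubes of distances. -/
noncomputable def ringSum (l : ZMod n) : ℝ :=
  ∑ s, chordWeight s * (1 - (stdAddChar (l * s)).re)

theorem ringSum_neg (l : ZMod n) : ringSum (-l) = ringSum l := by
  refine Finset.sum_congr rfl fun s _ => ?_
  rw [neg_mul, ← conj_stdAddChar, Complex.conj_re]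

theorem ringSum_zero : ringSum (0 : ZMod n) = 0 := by
  simp [ringSum]

theorem ringSum_nonneg (l : ZMod n) : 0 ≤ ringSum l :=
  Finset.sum_nonneg fun _ _ => mul_nonneg (by unfold chordWeight; positivity)
    (sub_nonneg.2 (re_stdAddChar_le_one _))

theorem ringSum_one_pos (hn : 2 ≤ n) : 0 < ringSum (1 : ZMod n) := by
  have hne : stdAddChar (1 : ZMod n) ≠ (1 : ℂ) := fun h =>
    one_ne_zero_zmod hn (ZMod.injective_stdAddChar (by rw [h, AddChar.map_zero_eq_one]))
  have hre : (stdAddChar (1 : ZMod n)).re ≠ 1 := fun h => by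
    have hnorm := AddChar.norm_apply stdAddChar (1 : ZMod n)
    rw [← h, eq_comm, Complex.re_eq_norm, Complex.nonneg_iff] at hnorm
    exact hne (Complex.ext h hnorm.2.symm)
  refine Finset.sum_pos' (fun s _ => mul_nonneg (by unfold chordWeight; positivity)
    (sub_nonneg.2 (re_stdAddChar_le_one _))) ⟨1, Finset.mem_univ _, ?_⟩
  have : 0 < ‖(1 : ℂ) - stdAddChar (1 : ZMod n)‖ := norm_pos_iff.2 (sub_ne_zero.2 hne.symm)
  rw [mul_one]
  exact mul_pos (by unfold chordWeight; positivity)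
    (sub_pos.2 (lt_of_le_of_ne (re_stdAddChar_le_one _) hre))

theorem sum_chordWeight_mul_one_sub (l : ZMod n) :
    ∑ s, (chordWeight s : ℂ) * (1 - stdAddChar (l * s)) = ringSum l := by
  have hreal : conj (∑ s, (chordWeight s : ℂ) * (1 - stdAddChar (l * s))) =
      ∑ s, (chordWeight s : ℂ) * (1 - stdAddChar (l * s)) := by
    rw [map_sum, ← Equiv.sum_comp (Equiv.neg (ZMod n))]
    refine Finset.sum_congr rfl fun s _ => ?_
    simp [conj_stdAddChar, chordWeight_neg]
  rw [← Complex.conj_eq_iff_re.1 hreal]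
  simp [ringSum]

/-- The vertices of the `n`-gon, numbered `1, …, n`, as residues modulo `n`. -/
noncomputable def vertexEquiv (n : ℕ) [NeZero n] : Fin n ≃ ZMod n :=
  Equiv.ofBijective (fun k => ((k : ℕ) + 1 : ZMod n)) <| by
    rw [Fintype.bijective_iff_injective_and_card]
    refine ⟨fun a b h => Fin.ext ?_, by simp [ZMod.card]⟩
    have hmod := (ZMod.natCast_eq_natCast_iff' _ _ _).1 (add_right_cancel h)
    rwa [Nat.mod_eq_of_lt a.2, Nat.mod_eq_of_lt b.2] at hmod

/-- The points `e j * u j`, `j : ZMod n`, followed by `c`: a planar configuration written in the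
frame that rotates with the vertices `e j` of the `n`-gon. -/
noncomputable def ringConfig (u : ZMod n → ℂ) (c : ℂ) : Fin (n + 1) → ℂ :=
  Fin.snoc (α := fun _ => ℂ)
    (fun k => stdAddChar (vertexEquiv n k) * u (vertexEquiv n k)) c

theorem exists_ringConfig_eq (w : Fin (n + 1) → ℂ) : ∃ u c, ringConfig u c = w := by
  refine ⟨fun j => stdAddChar (-j) * w ((vertexEquiv n).symm j).castSucc, w (Fin.last n),
    funext fun i => Fin.lastCases ?_ (fun k => ?_) i⟩
  · simp [ringConfig]
  · simp only [ringConfig, Fin.snoc_castSucc, Equiv.symm_apply_apply]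
    rw [← mul_assoc, stdAddChar_mul_neg, one_mul]

theorem exists_ringConfig_eq_mul_iff (u : ZMod n → ℂ) (c : ℂ) :
    (∃ t : ℂ, ∀ i, ringConfig u c i = t * ringConfig (fun _ => 1) 0 i) ↔
      c = 0 ∧ ∃ t, ∀ j, u j = t := by
  simp only [Fin.forall_fin_succ', ringConfig, Fin.snoc_castSucc, Fin.snoc_last, mul_one, mul_zero]
  constructor
  · rintro ⟨t, hring, hc⟩
    refine ⟨hc, t, fun j => mul_left_cancel₀ (stdAddChar_ne_zero j) ?_⟩
    simpa [mul_comm t] using hring ((vertexEquiv n).symm j)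
  · rintro ⟨hc, t, hu⟩
    exact ⟨t, fun k => by rw [hu, mul_comm], hc⟩

theorem planeC_centeredPolygon (i : Fin (n + 1)) :
    planeC (centeredPolygon n i) = ringConfig (fun _ => 1) 0 i := by
  refine Fin.lastCases ?_ (fun k => ?_) i
  · simp [centeredPolygon, ringConfig]
  · simp only [centeredPolygon, ringConfig, Fin.snoc_castSucc, planeC_apply, mul_one, vertexEquiv,
      Equiv.ofBijective_apply]
    have hexp := ZMod.stdAddChar_coe (N := n) ((k : ℤ) + 1)
    push_cast at hexp
    have harg : 2 * (Real.pi : ℂ) * Complex.I * ((k : ℕ) + 1) / n =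
        (((((k : ℕ) + 1 : ℝ) * (2 * Real.pi / n)) : ℝ) : ℂ) * Complex.I := by
      push_cast
      ring
    rw [hexp, harg, Complex.exp_mul_I, ← Complex.ofReal_cos, ← Complex.ofReal_sin]
    simp

theorem centeredPolygon_injective : Function.Injective (centeredPolygon n) := by
  suffices h : Function.Injective (ringConfig (n := n) (fun _ => 1) 0) from
    fun i j hij => h (by rw [← planeC_centeredPolygon, ← planeC_centeredPolygon, hij])
  intro i j
  refine Fin.lastCases ?_ (fun k => ?_) i <;> refine Fin.lastCases ?_ (fun k' => ?_) j
  · simp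
  · simpa [ringConfig] using fun h => absurd h.symm (stdAddChar_ne_zero _)
  · simpa [ringConfig] using fun h => absurd h (stdAddChar_ne_zero _)
  · intro h
    have hchar : stdAddChar (vertexEquiv n k) = (stdAddChar (vertexEquiv n k') : ℂ) := by
      simpa [ringConfig] using h
    rw [(vertexEquiv n).injective (ZMod.injective_stdAddChar hchar)]

theorem momentOfInertia_centeredPolygon_pos (m : ℝ) :
    0 < momentOfInertia (centeredPolygonMass n m) (centeredPolygon n) := by
  have hnorm : ∀ i, ‖centeredPolygon n i‖ = ‖ringConfig (n := n) (fun _ => 1) 0 i‖ := fun i => by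
    rw [← planeC_centeredPolygon, planeC.norm_map]
  rw [momentOfInertia, Fin.sum_univ_castSucc]
  simp only [hnorm]
  simpa [centeredPolygonMass, ringConfig] using Nat.pos_of_ne_zero (NeZero.ne n)

theorem sum_centeredPolygonMass_mul (m : ℝ) (f : Fin (n + 1) → ℂ) {g : ZMod n → ℂ}
    (hfg : ∀ k : Fin n, f k.castSucc = g (vertexEquiv n k)) :
    ∑ i, (centeredPolygonMass n m i : ℂ) * f i = ∑ j, g j + m * f (Fin.last n) := by
  rw [Fin.sum_univ_castSucc, ← Equiv.sum_comp (vertexEquiv n)]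
  simp [centeredPolygonMass, hfg]

theorem centeredPolygon_balanced (hn : 2 ≤ n) (m : ℝ) (i : Fin (n + 1)) :
    ∑ j, (centeredPolygonMass n m j : ℂ) * (‖ringConfig (n := n) (fun _ => 1) 0 i -
        ringConfig (fun _ => 1) 0 j‖⁻¹ ^ 3 : ℝ) *
        (ringConfig (fun _ => 1) 0 i - ringConfig (fun _ => 1) 0 j) =
      (m + ringSum (1 : ZMod n) : ℝ) * ringConfig (fun _ => 1) 0 i := by
  simp only [mul_assoc]
  refine Fin.lastCases ?_ (fun k => ?_) i
  · rw [sum_centeredPolygonMass_mul (g := fun j => -stdAddChar j) m _ fun k => by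
      simp [ringConfig]]
    simp [ringConfig, sum_stdAddChar_of_two_le hn]
  · generalize hj : vertexEquiv n k = j
    rw [sum_centeredPolygonMass_mul (g := fun i => (‖stdAddChar j - stdAddChar i‖⁻¹ ^ 3 : ℝ) *
      (stdAddChar j - stdAddChar i)) m _ fun k => by simp [ringConfig, hj],
      ← Equiv.sum_comp (Equiv.addLeft j)]
    simp only [Equiv.coe_addLeft, stdAddChar_sub_stdAddChar_add, norm_mul, AddChar.norm_apply,
      one_mul, ringConfig, Fin.snoc_castSucc, Fin.snoc_last, mul_one, hj, sub_zero]
    have hring := sum_chordWeight_mul_one_sub (1 : ZMod n)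
    simp only [one_mul, chordWeight] at hring
    simp only [mul_left_comm _ (stdAddChar j), ← Finset.mul_sum, hring]
    push_cast
    ring

/-- The linearised force on the ring particle `j`, in the frame rotating with the vertices. -/
noncomputable def ringForce (m : ℝ) (u : ZMod n → ℂ) (c : ℂ) (j : ZMod n) : ℂ :=
  ∑ s, (chordWeight s : ℂ) * (1 / 2 * (u j - stdAddChar s * u (j + s)) +
      3 / 2 * (conj (u (j + s)) - stdAddChar s * conj (u j)))
    + m * (1 / 2 * (u j - stdAddChar (-j) * c) +
      3 / 2 * (conj (u j) - stdAddChar j * conj c))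
    + (m + ringSum (1 : ZMod n) : ℝ) * u j

/-- The linearised force on the central particle. -/
noncomputable def centerForce (m : ℝ) (u : ZMod n → ℂ) (c : ℂ) : ℂ :=
  ∑ j, (1 / 2 * (c - stdAddChar j * u j) - 3 / 2 * (stdAddChar j * conj (u j)))
    + (m + ringSum (1 : ZMod n) : ℝ) * c

theorem tidal_ring_ring (u : ZMod n → ℂ) (j s : ZMod n) :
    tidal (stdAddChar j - stdAddChar (j + s))
      (stdAddChar j * u j - stdAddChar (j + s) * u (j + s)) =
    stdAddChar j * ((chordWeight s : ℂ) * (1 / 2 * (u j - stdAddChar s * u (j + s)) +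
      3 / 2 * (conj (u (j + s)) - stdAddChar s * conj (u j)))) := by
  rw [stdAddChar_sub_stdAddChar_add, AddChar.map_add_eq_mul, mul_assoc, ← mul_sub,
    tidal_mul_mul (AddChar.norm_apply _ j), tidal_one_sub (AddChar.norm_apply _ s), chordWeight]

theorem tidal_ring_center (v c : ℂ) (j : ZMod n) :
    tidal (stdAddChar j) (stdAddChar j * v - c) =
    stdAddChar j * (1 / 2 * (v - stdAddChar (-j) * c) +
      3 / 2 * (conj v - stdAddChar j * conj c)) := by
  have hδ : stdAddChar j * v - c = stdAddChar j * (v - stdAddChar (-j) * c) := by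
    linear_combination c * stdAddChar_mul_neg j
  have hrot := tidal_mul_mul (AddChar.norm_apply stdAddChar j) 1 (v - stdAddChar (-j) * c)
  rw [mul_one] at hrot
  rw [hδ, hrot, tidal_one, map_sub, map_mul, conj_stdAddChar, neg_neg]

theorem tidal_center_ring (v c : ℂ) (j : ZMod n) :
    tidal (-stdAddChar j) (c - stdAddChar j * v) =
    1 / 2 * (c - stdAddChar j * v) - 3 / 2 * (stdAddChar j * conj v) +
      3 / 2 * conj c * stdAddChar (2 * j) := by
  rw [← neg_sub (stdAddChar j * v), tidal_neg_neg, tidal_ring_center, two_mul,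
    AddChar.map_add_eq_mul]
  linear_combination 1 / 2 * c * stdAddChar_mul_neg j

theorem sum_tidal_ring (m : ℝ) (u : ZMod n → ℂ) (c : ℂ) (k : Fin n) :
    ∑ i, (centeredPolygonMass n m i : ℂ) *
        tidal (ringConfig (fun _ => 1) 0 k.castSucc - ringConfig (fun _ => 1) 0 i)
          (ringConfig u c k.castSucc - ringConfig u c i) +
      (m + ringSum (1 : ZMod n) : ℝ) * ringConfig u c k.castSucc =
    stdAddChar (vertexEquiv n k) * ringForce m u c (vertexEquiv n k) := by
  generalize hj : vertexEquiv n k = j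
  rw [sum_centeredPolygonMass_mul (g := fun i => tidal (stdAddChar j - stdAddChar i)
    (stdAddChar j * u j - stdAddChar i * u i)) m _ fun k => by simp [ringConfig, hj],
    ← Equiv.sum_comp (Equiv.addLeft j)]
  simp only [Equiv.coe_addLeft, tidal_ring_ring, ringConfig, Fin.snoc_castSucc, Fin.snoc_last,
    mul_one, hj, sub_zero, tidal_ring_center]
  rw [← Finset.mul_sum, ringForce]
  ring

theorem sum_tidal_center (hn : 3 ≤ n) (m : ℝ) (u : ZMod n → ℂ) (c : ℂ) :
    ∑ i, (centeredPolygonMass n m i : ℂ) *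
        tidal (ringConfig (fun _ => 1) 0 (Fin.last n) - ringConfig (fun _ => 1) 0 i)
          (ringConfig u c (Fin.last n) - ringConfig u c i) +
      (m + ringSum (1 : ZMod n) : ℝ) * ringConfig u c (Fin.last n) = centerForce m u c := by
  rw [sum_centeredPolygonMass_mul (g := fun j => tidal (-stdAddChar j) (c - stdAddChar j * u j))
    m _ fun k => by simp [ringConfig]]
  simp only [tidal_center_ring, Finset.sum_add_distrib, ← Finset.mul_sum, sum_stdAddChar_mul,
    if_neg (two_ne_zero_zmod hn), centerForce]
  simp [tidal, ringConfig]

theorem isDegenerate_iff_ringForce (hn : 3 ≤ n) {m : ℝ} (hm : 0 < m) :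
    IsDegenerate (centeredPolygonMass n m) (centeredPolygon n) ↔
      ∃ (u : ZMod n → ℂ) (c : ℂ), (∀ j, ringForce m u c j = 0) ∧ centerForce m u c = 0 ∧
        ¬ (c = 0 ∧ ∃ t, ∀ j, u j = t) := by
  have hpos : 0 < m + ringSum (1 : ZMod n) := add_pos hm (ringSum_one_pos (by omega))
  have hsystem : ∀ (u : ZMod n → ℂ) (c : ℂ), (∀ i, ∑ j, (centeredPolygonMass n m j : ℂ) *
        tidal (ringConfig (fun _ => 1) 0 i - ringConfig (fun _ => 1) 0 j)
          (ringConfig u c i - ringConfig u c j) +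
        (m + ringSum (1 : ZMod n) : ℝ) * ringConfig u c i = 0) ↔
      (∀ j, ringForce m u c j = 0) ∧ centerForce m u c = 0 := fun u c => by
    rw [Fin.forall_fin_succ', sum_tidal_center hn]
    simp only [sum_tidal_ring, mul_eq_zero, stdAddChar_ne_zero, false_or,
      (vertexEquiv n).forall_congr_left, Equiv.apply_symm_apply]
  rw [isDegenerate_iff_tidal hpos.ne' (centeredPolygonMass_ne_zero hm.ne')
    centeredPolygon_injective (momentOfInertia_centeredPolygon_pos m) planeC_centeredPolygon
    (centeredPolygon_balanced (by omega) m)]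
  constructor
  · rintro ⟨w, hker, htriv⟩
    obtain ⟨u, c, rfl⟩ := exists_ringConfig_eq w
    rw [exists_ringConfig_eq_mul_iff] at htriv
    exact ⟨u, c, ((hsystem u c).1 hker).1, ((hsystem u c).1 hker).2, htriv⟩
  · rintro ⟨u, c, hring, hcenter, htriv⟩
    exact ⟨ringConfig u c, (hsystem u c).2 ⟨hring, hcenter⟩,
      (exists_ringConfig_eq_mul_iff u c).not.2 htriv⟩

end RegularPolygon

/-! ### Fourier modes -/

section FourierModes

variable {n : ℕ} [NeZero n]

theorem dft_comp_add_right (f : ZMod n → ℂ) (s l : ZMod n) :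
    ZMod.dft (fun j => f (j + s)) l = stdAddChar (l * s) * ZMod.dft f l := by
  simp only [ZMod.dft_apply, smul_eq_mul]
  rw [← Equiv.sum_comp (Equiv.addRight s) (fun j => stdAddChar (-(j * l)) * f j), Finset.mul_sum]
  refine Finset.sum_congr rfl fun j _ => ?_
  rw [← mul_assoc, ← AddChar.map_add_eq_mul, Equiv.coe_addRight]
  ring_nf

theorem dft_conj (f : ZMod n → ℂ) (l : ZMod n) :
    ZMod.dft (fun j => conj (f j)) l = conj (ZMod.dft f (-l)) := by
  simp [ZMod.dft_apply, conj_stdAddChar]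

theorem dft_stdAddChar_mul (a l : ZMod n) :
    ZMod.dft (fun j => stdAddChar (a * j)) l = if l = a then (n : ℂ) else 0 := by
  simp only [ZMod.dft_apply, smul_eq_mul, ← AddChar.map_add_eq_mul]
  rw [if_congr ((eq_comm (a := l)).trans sub_eq_zero.symm) rfl rfl, ← sum_stdAddChar_mul]
  refine Finset.sum_congr rfl fun j _ => ?_
  ring_nf

theorem dft_const (t : ℂ) (l : ZMod n) :
    ZMod.dft (fun _ => t) l = if l = 0 then (n : ℂ) * t else 0 := by
  have hone := dft_stdAddChar_mul (0 : ZMod n) l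
  simp only [zero_mul, AddChar.map_zero_eq_one] at hone
  have hmul := congrFun (ZMod.dft_mul_const (fun _ : ZMod n => (1 : ℂ)) t) l
  simp only [one_mul, hone] at hmul
  rw [hmul, ite_mul, zero_mul]

theorem exists_eq_const_iff_dft_eq_zero (u : ZMod n → ℂ) :
    (∃ t, ∀ j, u j = t) ↔ ∀ l ≠ 0, ZMod.dft u l = 0 := by
  constructor
  · rintro ⟨t, ht⟩ l hl
    simp only [funext ht, dft_const, if_neg hl]
  · intro h
    refine ⟨(n : ℂ)⁻¹ * ZMod.dft u 0, congrFun (ZMod.dft.injective (funext fun l => ?_))⟩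
    rw [dft_const]
    split_ifs with hl
    · rw [hl, mul_inv_cancel_left₀ (NeZero.ne _)]
    · exact h l hl

theorem sum_chordWeight_mul (x y : ℂ) (l : ZMod n) :
    ∑ s, (chordWeight s : ℂ) * (1 / 2 * (x - stdAddChar s * (stdAddChar (l * s) * x)) +
      3 / 2 * (stdAddChar (l * s) * y - stdAddChar s * y)) =
    ringSum (l + 1) / 2 * x + 3 / 2 * (ringSum (1 : ZMod n) - ringSum l) * y := by
  simp only [← sum_chordWeight_mul_one_sub, Finset.sum_div, Finset.mul_sum, Finset.sum_mul,
    ← Finset.sum_sub_distrib, ← Finset.sum_add_distrib]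
  refine Finset.sum_congr rfl fun s _ => ?_
  rw [add_mul, one_mul, AddChar.map_add_eq_mul]
  ring

/-- The coefficient with which the `l`-th Fourier mode of the ring acts on itself. -/
noncomputable def selfCoeff (m : ℝ) (l : ZMod n) : ℝ :=
  ringSum (l + 1) / 2 + 3 * m / 2 + ringSum (1 : ZMod n)

/-- The coefficient with which the conjugate of the `-l`-th Fourier mode of the ring acts on the
`l`-th one. -/
noncomputable def crossCoeff (m : ℝ) (l : ZMod n) : ℝ :=
  3 / 2 * (ringSum (1 : ZMod n) - ringSum l) + 3 * m / 2

theorem dft_ringForce (m : ℝ) (u : ZMod n → ℂ) (c : ℂ) (l : ZMod n) :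
    ZMod.dft (ringForce m u c) l =
      selfCoeff m l * ZMod.dft u l + crossCoeff m l * conj (ZMod.dft u (-l)) -
        n * m * ((if l = -1 then c / 2 else 0) + if l = 1 then 3 / 2 * conj c else 0) := by
  have hforce : ringForce m u c = ∑ s, (chordWeight s : ℂ) •
      ((1 / 2 : ℂ) • (u - stdAddChar s • fun j => u (j + s)) +
        (3 / 2 : ℂ) • ((fun j => conj (u (j + s))) - stdAddChar s • fun j => conj (u j))) +
      (m : ℂ) • ((1 / 2 : ℂ) • (u - c • fun j => stdAddChar (-1 * j)) +
        (3 / 2 : ℂ) • ((fun j => conj (u j)) - conj c • fun j => stdAddChar (1 * j))) +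
      ((m + ringSum (1 : ZMod n) : ℝ) : ℂ) • u := by
    funext j
    simp only [ringForce, Pi.add_apply, Finset.sum_apply, Pi.smul_apply, Pi.sub_apply,
      smul_eq_mul, neg_one_mul, one_mul, mul_comm c, mul_comm (conj c)]
  rw [hforce]
  simp only [map_add, map_sum, map_smul, map_sub, Pi.add_apply, Finset.sum_apply, Pi.smul_apply,
    Pi.sub_apply, smul_eq_mul, dft_comp_add_right u, dft_comp_add_right fun j => conj (u j),
    dft_conj, dft_stdAddChar_mul, sum_chordWeight_mul, selfCoeff, crossCoeff]
  push_cast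
  split_ifs <;> ring

theorem centerForce_eq (m : ℝ) (u : ZMod n → ℂ) (c : ℂ) :
    centerForce m u c = (n / 2 + m + ringSum (1 : ZMod n)) * c -
      (ZMod.dft u (-1) / 2 + 3 / 2 * conj (ZMod.dft u 1)) := by
  have hneg : ZMod.dft u (-1) = ∑ j, stdAddChar j * u j := by simp [ZMod.dft_apply]
  have hpos : conj (ZMod.dft u 1) = ∑ j, stdAddChar j * conj (u j) := by
    simp [ZMod.dft_apply, conj_stdAddChar]
  rw [centerForce, hneg, hpos]
  simp only [Finset.sum_sub_distrib, ← Finset.mul_sum]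
  simp
  ring

/-- The Fourier transform of the linearised equations of motion: `F` is the transform of the
displacement of the ring, in the rotating frame, and `c` the displacement of the center. -/
structure IsFourierKernel (m : ℝ) (F : ZMod n → ℂ) (c : ℂ) : Prop where
  ring_eq : ∀ l, selfCoeff m l * F l + crossCoeff m l * conj (F (-l)) =
    n * m * ((if l = -1 then c / 2 else 0) + if l = 1 then 3 / 2 * conj c else 0)
  center_eq : (n / 2 + m + ringSum (1 : ZMod n)) * c = F (-1) / 2 + 3 / 2 * conj (F 1)

theorem isDegenerate_iff_isFourierKernel (hn : 3 ≤ n) {m : ℝ} (hm : 0 < m) :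
    IsDegenerate (centeredPolygonMass n m) (centeredPolygon n) ↔
      ∃ (F : ZMod n → ℂ) (c : ℂ), IsFourierKernel m F c ∧ ¬ (c = 0 ∧ ∀ l ≠ 0, F l = 0) := by
  rw [isDegenerate_iff_ringForce hn hm]
  refine Iff.trans ?_ (ZMod.dft (N := n) (E := ℂ)).surjective.exists.symm
  refine exists_congr fun u => exists_congr fun c => ?_
  rw [exists_eq_const_iff_dft_eq_zero, ← and_assoc]
  refine and_congr_left fun _ => ?_
  have hring : (∀ j, ringForce m u c j = 0) ↔ ∀ l, ZMod.dft (ringForce m u c) l = 0 := by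
    simp only [← Pi.zero_apply (M := fun _ : ZMod n => ℂ), ← funext_iff]
    exact ZMod.dft.map_eq_zero_iff.symm
  simp only [hring, dft_ringForce, centerForce_eq, sub_eq_zero]
  exact ⟨fun h => ⟨h.1, h.2⟩, fun h => ⟨h.1, h.2⟩⟩

/-- The determinant of the system coupling the `l`-th and the `-l`-th Fourier modes, for
`l ≠ ±1`. -/
noncomputable def modeDet (m : ℝ) (l : ZMod n) : ℝ :=
  selfCoeff m l * selfCoeff m (-l) - crossCoeff m l ^ 2

/-- The determinant of the system coupling the Fourier modes `±1` and the center, up to the factor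
`m + ringSum 1` that accounts for the translations. -/
noncomputable def firstModeDet (n : ℕ) [NeZero n] (m : ℝ) : ℝ :=
  selfCoeff m (1 : ZMod n) * ((n + 3 * m) / 2 + ringSum (1 : ZMod n)) - 9 / 4 * m * (m + n)

theorem ofReal_firstModeDet (m : ℝ) :
    (firstModeDet n m : ℂ) = selfCoeff m (1 : ZMod n) * ((n + 3 * m) / 2 + ringSum (1 : ZMod n)) -
      9 / 4 * m * (m + n) := by
  rw [firstModeDet]
  push_cast
  ring

theorem ofReal_modeDet (m : ℝ) (l : ZMod n) :
    (modeDet m l : ℂ) = selfCoeff m l * selfCoeff m (-l) - crossCoeff m l ^ 2 := by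
  rw [modeDet]
  push_cast
  ring

theorem crossCoeff_neg (m : ℝ) (l : ZMod n) : crossCoeff m (-l) = crossCoeff m l := by
  rw [crossCoeff, ringSum_neg, crossCoeff]

theorem modeDet_neg (m : ℝ) (l : ZMod n) : modeDet m (-l) = modeDet m l := by
  rw [modeDet, crossCoeff_neg, neg_neg, mul_comm, modeDet]

theorem selfCoeff_neg_one (m : ℝ) :
    selfCoeff m (-1 : ZMod n) = 3 * m / 2 + ringSum (1 : ZMod n) := by
  simp [selfCoeff, ringSum_zero]

theorem crossCoeff_one (m : ℝ) : crossCoeff m (1 : ZMod n) = 3 * m / 2 := by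
  simp [crossCoeff]

theorem selfCoeff_pos {m : ℝ} (hm : 0 < m) (l : ZMod n) : 0 < selfCoeff m l := by
  have := ringSum_nonneg (l + 1)
  have := ringSum_nonneg (1 : ZMod n)
  unfold selfCoeff
  positivity

namespace IsFourierKernel

variable {m : ℝ} {F : ZMod n → ℂ} {c : ℂ}

theorem eq_zero_of_firstModeDet_ne_zero (h : IsFourierKernel m F c) (hn : 3 ≤ n) (hm : 0 < m)
    (hdet : firstModeDet n m ≠ 0) : c = 0 ∧ F 1 = 0 ∧ F (-1) = 0 := by
  have hone := h.ring_eq 1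
  have hneg := congrArg conj (h.ring_eq (-1))
  have hcenter := congrArg conj h.center_eq
  simp only [neg_neg, if_neg (one_ne_neg_one_zmod hn), if_neg (one_ne_neg_one_zmod hn).symm,
    crossCoeff_neg, selfCoeff_neg_one, crossCoeff_one, map_add, map_mul, map_div₀, map_ofNat,
    map_natCast, Complex.conj_conj, Complex.conj_ofReal, if_true, map_zero] at hone hneg hcenter
  have hdet' := Complex.ofReal_ne_zero.2 hdet
  rw [ofReal_firstModeDet] at hdet'
  have hpos : (n * (m + ringSum (1 : ZMod n)) : ℂ) ≠ 0 := by
    have := ringSum_one_pos (n := n) (by omega)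
    have := Nat.pos_of_ne_zero (NeZero.ne n)
    exact_mod_cast (by positivity : (n * (m + ringSum (1 : ZMod n)) : ℝ) ≠ 0)
  push_cast at hone hneg hcenter
  have hF1 : F 1 = 0 := (mul_eq_zero.1 (by
    linear_combination ((n + 3 * m) / 2 + ringSum (1 : ZMod n)) * hone -
      3 * m / 2 * (hneg - n * hcenter))).resolve_left hdet'
  have hcomb : conj (F (-1)) - n * conj c = 0 := (mul_eq_zero.1 (by
    linear_combination selfCoeff m (1 : ZMod n) * (hneg - n * hcenter) -
      3 * (m + n) / 2 * hone)).resolve_left hdet'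
  have hc : conj c = 0 := (mul_eq_zero.1 (by
    linear_combination hneg - 3 * m / 2 * hF1 -
      (3 * m / 2 + ringSum (1 : ZMod n)) * hcomb)).resolve_left hpos
  exact ⟨by simpa using hc, hF1, by simpa [hc] using hcomb⟩

theorem eq_zero_of_modeDet_ne_zero (h : IsFourierKernel m F 0) {l : ZMod n}
    (hdet : modeDet m l ≠ 0) : F l = 0 := by
  have hl := h.ring_eq l
  have hneg := congrArg conj (h.ring_eq (-l))
  simp only [neg_neg, crossCoeff_neg, map_add, map_mul, map_zero, zero_div, mul_zero, ite_self,
    add_zero, Complex.conj_conj, Complex.conj_ofReal] at hl hneg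
  have hdet' := Complex.ofReal_ne_zero.2 hdet
  rw [ofReal_modeDet] at hdet'
  exact (mul_eq_zero.1 (by
    linear_combination selfCoeff m (-l) * hl - crossCoeff m l * hneg)).resolve_left hdet'

theorem of_firstModeDet_eq_zero (hn : 3 ≤ n) (hdet : firstModeDet n m = 0) :
    IsFourierKernel m
      (Pi.single (1 : ZMod n) (n * (m + ringSum (1 : ZMod n)) * (3 * m / 2) : ℂ) +
        Pi.single (-1) (n * ((3 * m / 2 + ringSum (1 : ZMod n)) * selfCoeff m (1 : ZMod n) -
          9 / 4 * m ^ 2 - (m + ringSum (1 : ZMod n)) * selfCoeff m (1 : ZMod n)) : ℂ))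
      ((3 * m / 2 + ringSum (1 : ZMod n)) * selfCoeff m (1 : ZMod n) - 9 / 4 * m ^ 2) := by
  have hne := one_ne_neg_one_zmod hn
  have hdet' := ofReal_firstModeDet (n := n) m
  rw [hdet, Complex.ofReal_zero] at hdet'
  constructor
  · intro l
    by_cases h1 : l = 1
    · subst h1
      simp [hne, hne.symm, Complex.conj_ofNat, crossCoeff_one]
      ring
    by_cases h2 : l = -1
    · subst h2
      simp [hne, hne.symm, Complex.conj_ofNat, crossCoeff_one, crossCoeff_neg, selfCoeff_neg_one]
      ring
    · have h3 : -l ≠ 1 := fun h => h2 (by rw [← h, neg_neg])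
      simp [h1, h2, h3]
  · simp [hne, hne.symm, Complex.conj_ofNat]
    linear_combination -(m + ringSum (1 : ZMod n)) * hdet'

theorem of_modeDet_eq_zero {l : ZMod n} (h1 : l ≠ 1) (hneg1 : l ≠ -1) (hdet : modeDet m l = 0)
    (t : ℂ) :
    IsFourierKernel m
      (Pi.single l (t * crossCoeff m l) + Pi.single (-l) (-(conj t * selfCoeff m l))) 0 := by
  have hdet' := ofReal_modeDet m l
  rw [hdet, Complex.ofReal_zero] at hdet'
  constructor
  · intro k
    simp only [Pi.add_apply, Pi.single_apply, neg_eq_iff_eq_neg (a := k)]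
    by_cases hk : k = l <;> by_cases hneg : k = -l
    · subst hk
      rw [← hneg] at hdet'
      simp [← hneg]
      linear_combination conj t * hdet'
    · subst hk
      simp [hneg]
      ring
    · subst hneg
      simp [hk, crossCoeff_neg]
      linear_combination conj t * hdet'
    · simp [hk, hneg]
  · have hneg1' : 1 ≠ -l := fun h => hneg1 (by rw [h, neg_neg])
    simp [h1.symm, hneg1.symm, hneg1']

end IsFourierKernel

theorem isDegenerate_iff_modeDet_zmod (hn : 3 ≤ n) {m : ℝ} (hm : 0 < m) :
    IsDegenerate (centeredPolygonMass n m) (centeredPolygon n) ↔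
      firstModeDet n m = 0 ∨ ∃ l : ZMod n, l ≠ 0 ∧ l ≠ 1 ∧ l ≠ -1 ∧ modeDet m l = 0 := by
  rw [isDegenerate_iff_isFourierKernel hn hm]
  constructor
  · rintro ⟨F, c, hF, htriv⟩
    by_contra! hdet
    obtain ⟨rfl, hF1, hFneg1⟩ := hF.eq_zero_of_firstModeDet_ne_zero hn hm hdet.1
    refine htriv ⟨rfl, fun l hl => ?_⟩
    by_cases h1 : l = 1
    · rw [h1, hF1]
    by_cases hneg1 : l = -1
    · rw [hneg1, hFneg1]
    exact hF.eq_zero_of_modeDet_ne_zero (hdet.2 l hl h1 hneg1)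
  · rintro (hdet | ⟨l, hl, h1, hneg1, hdet⟩)
    · refine ⟨_, _, .of_firstModeDet_eq_zero hn hdet, fun htriv => ?_⟩
      have hF1 := htriv.2 1 (one_ne_zero_zmod (by omega))
      have hS := ringSum_one_pos (n := n) (by omega)
      have : 0 < n := by omega
      refine (by positivity : (n * (m + ringSum (1 : ZMod n)) * (3 * m / 2) : ℝ) ≠ 0) ?_
      rw [← Complex.ofReal_eq_zero]
      simpa [one_ne_neg_one_zmod hn] using hF1
    · by_contra! htriv
      have hzero := fun t => (htriv _ _ (.of_modeDet_eq_zero h1 hneg1 hdet t)).2 (-l) (by simpa)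
      have hself : (selfCoeff m l : ℂ) ≠ 0 := Complex.ofReal_ne_zero.2 (selfCoeff_pos hm l).ne'
      have hone := hzero 1
      have hI := hzero Complex.I
      by_cases hl2 : -l = l
      · simp only [Pi.add_apply, hl2, Pi.single_eq_same, map_one, Complex.conj_I] at hone hI
        exact hself (by linear_combination (-1 / 2) * hone - Complex.I / 2 * hI +
          (crossCoeff m l + selfCoeff m l) / 2 * Complex.I_sq)
      · exact hself (by simpa [hl2] using hone)

theorem isDegenerate_iff_modeDet (hn : 3 ≤ n) {m : ℝ} (hm : 0 < m) :
    IsDegenerate (centeredPolygonMass n m) (centeredPolygon n) ↔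
      firstModeDet n m = 0 ∨ ∃ l : ℕ, 2 ≤ l ∧ l ≤ n / 2 ∧ modeDet m (l : ZMod n) = 0 := by
  rw [isDegenerate_iff_modeDet_zmod hn hm]
  refine or_congr_right ⟨?_, ?_⟩
  · rintro ⟨l, hl, h1, hneg1, hdet⟩
    obtain ⟨k, hk, rfl⟩ : ∃ k < n, (k : ZMod n) = l := ⟨l.val, l.val_lt, l.natCast_zmod_val⟩
    have hk0 : k ≠ 0 := by rintro rfl; exact hl Nat.cast_zero
    have hk1 : k ≠ 1 := by rintro rfl; exact h1 Nat.cast_one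
    have hsub : ((n - k : ℕ) : ZMod n) = -k := by simp [Nat.cast_sub hk.le]
    have hkn : n - k ≠ 1 := fun h =>
      hneg1 (by rw [← neg_neg (k : ZMod n), ← hsub, h, Nat.cast_one])
    rcases le_or_gt k (n / 2) with hle | hgt
    · exact ⟨k, by omega, hle, hdet⟩
    · exact ⟨n - k, by omega, by omega, by rw [hsub, modeDet_neg, hdet]⟩
  · rintro ⟨l, h2, hl, hdet⟩
    refine ⟨l, natCast_zmod_ne_zero (by omega) (by omega), fun h => ?_, fun h => ?_, hdet⟩
    · exact natCast_zmod_ne_zero (n := n) (l := l - 1) (by omega) (by omega)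
        (by rw [Nat.cast_sub (by omega), h, Nat.cast_one, sub_self])
    · exact natCast_zmod_ne_zero (n := n) (l := l + 1) (by omega) (by omega)
        (by rw [Nat.cast_add, h, Nat.cast_one, neg_add_cancel])

end FourierModes

/-! ### The roots of the mode determinants -/

section ModeRoots

variable {n : ℕ} [NeZero n]

theorem sum_zmod_eq_sum_range (f : ZMod n → ℝ) : ∑ s, f s = ∑ s ∈ Finset.range n, f s := by
  symm
  exact Finset.sum_nbij' (fun s : ℕ => (s : ZMod n)) ZMod.val (by simp)
    (fun s _ => Finset.mem_range.2 (ZMod.val_lt s))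
    (fun s hs => ZMod.val_cast_of_lt (Finset.mem_range.1 hs))
    (fun s _ => ZMod.natCast_zmod_val s) (by simp)

theorem re_stdAddChar_natCast (k : ℕ) :
    (stdAddChar (k : ZMod n)).re = Real.cos (2 * Real.pi * k / n) := by
  have harg : 2 * (Real.pi : ℂ) * Complex.I * k / n =
      ((2 * Real.pi * k / n : ℝ) : ℂ) * Complex.I := by
    push_cast
    ring
  rw [← Int.cast_natCast (R := ZMod n), ZMod.stdAddChar_coe, Int.cast_natCast, harg,
    Complex.exp_ofReal_mul_I_re]

theorem norm_one_sub_stdAddChar_sq (s : ZMod n) :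
    ‖(1 : ℂ) - stdAddChar s‖ ^ 2 = 2 * (1 - (stdAddChar s).re) := by
  have hnorm := Complex.sq_norm (stdAddChar s)
  rw [AddChar.norm_apply, Complex.normSq_apply] at hnorm
  rw [Complex.sq_norm, Complex.normSq_apply]
  simp only [Complex.sub_re, Complex.sub_im, Complex.one_re, Complex.one_im]
  linear_combination -hnorm

omit [NeZero n] in
theorem sin_pi_mul_div_nonneg {s : ℕ} (hs : s ≤ n) : 0 ≤ Real.sin (Real.pi * s / n) := by
  refine Real.sin_nonneg_of_nonneg_of_le_pi (by positivity) ?_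
  refine div_le_of_le_mul₀ n.cast_nonneg Real.pi_pos.le ?_
  gcongr

theorem norm_one_sub_stdAddChar_natCast {s : ℕ} (hs : s ≤ n) :
    ‖(1 : ℂ) - stdAddChar (s : ZMod n)‖ = 2 * Real.sin (Real.pi * s / n) := by
  have hsin := sin_pi_mul_div_nonneg hs
  have hdouble : 2 * Real.pi * s / n = 2 * (Real.pi * s / n) := by ring
  rw [← sq_eq_sq₀ (norm_nonneg _) (by positivity), norm_one_sub_stdAddChar_sq,
    re_stdAddChar_natCast, hdouble, Real.cos_two_mul, Real.cos_sq']
  ring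

/-- The Fourier coefficients of the inverse distances between the vertices of the regular `n`-gon;
they are the second differences of `ringSum`. -/
noncomputable def ringCos (l : ZMod n) : ℝ :=
  ∑ s, ‖(1 : ℂ) - stdAddChar s‖⁻¹ * (stdAddChar (l * s)).re

theorem ringCos_neg (l : ZMod n) : ringCos (-l) = ringCos l := by
  refine Finset.sum_congr rfl fun s _ => ?_
  rw [neg_mul, ← conj_stdAddChar, Complex.conj_re]

theorem ringSum_second_difference (l : ZMod n) :
    ringSum (l + 1) - 2 * ringSum l + ringSum (l - 1) = ringCos l := by
  rw [ringCos, ringSum, ringSum, ringSum, Finset.mul_sum, ← Finset.sum_sub_distrib,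
    ← Finset.sum_add_distrib]
  refine Finset.sum_congr rfl fun s _ => ?_
  have hnorm := norm_one_sub_stdAddChar_sq s
  rw [add_mul, sub_mul, one_mul, sub_eq_add_neg (l * s), AddChar.map_add_eq_mul,
    AddChar.map_add_eq_mul, ← conj_stdAddChar s, chordWeight]
  simp only [Complex.mul_re, Complex.conj_re, Complex.conj_im]
  rcases eq_or_ne ‖(1 : ℂ) - stdAddChar s‖ 0 with h0 | h0
  · simp [h0]
  · field_simp
    rw [hnorm]
    ring

theorem ringCos_zero : ringCos (0 : ZMod n) = 2 * ringSum (1 : ZMod n) := by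
  have hdiff := ringSum_second_difference (0 : ZMod n)
  rw [zero_add, zero_sub, ringSum_neg, ringSum_zero] at hdiff
  linarith

theorem ringSum_one_eq_sum_range :
    ringSum (1 : ZMod n) = ∑ s ∈ Finset.range n, (Real.sin (Real.pi * s / n))⁻¹ / 4 := by
  have hcos := ringCos_zero (n := n)
  rw [ringCos, sum_zmod_eq_sum_range] at hcos
  rw [eq_div_of_mul_eq two_ne_zero (mul_comm _ _ |>.trans hcos.symm), Finset.sum_div]
  refine Finset.sum_congr rfl fun s hs => ?_
  rw [norm_one_sub_stdAddChar_natCast (Finset.mem_range.1 hs).le, zero_mul,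
    AddChar.map_zero_eq_one, Complex.one_re, mul_inv]
  ring

theorem two_mul_sin_half_mul_sum_range_sin (α : ℝ) (n : ℕ) :
    2 * Real.sin (α / 2) * ∑ s ∈ Finset.range n, Real.sin (α * s) =
      Real.cos (α / 2) - Real.cos (α * n - α / 2) := by
  induction n with
  | zero => simp
  | succ k ih =>
    have hshift : α * (k + 1 : ℕ) - α / 2 = α * k + α / 2 := by
      push_cast
      ring
    rw [Finset.sum_range_succ, mul_add, ih, hshift, Real.cos_add, Real.cos_sub]
    ring

/-- The angle `(2 l + 1) π / (2 n)`, halfway between the multiples `l π / n` and `(l + 1) π / n`. -/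
noncomputable def halfAngle (n l : ℕ) : ℝ := (2 * l + 1) * Real.pi / (2 * n)

theorem ringCos_sub_ringCos_add_one_eq_sum_sin (l : ℕ) :
    ringCos (l : ZMod n) - ringCos ((l : ZMod n) + 1) =
      ∑ s ∈ Finset.range n, Real.sin (2 * halfAngle n l * s) := by
  have hn : (0 : ℝ) < n := mod_cast NeZero.pos n
  rw [ringCos, ringCos, ← Finset.sum_sub_distrib, sum_zmod_eq_sum_range]
  refine Finset.sum_congr rfl fun s hs => ?_
  have hl : (stdAddChar ((l : ZMod n) * (s : ZMod n))).re =
      Real.cos (2 * halfAngle n l * s - Real.pi * s / n) := by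
    rw [← Nat.cast_mul, re_stdAddChar_natCast, halfAngle]
    congr 1
    push_cast
    field_simp
    ring
  have hl1 : (stdAddChar (((l : ZMod n) + 1) * (s : ZMod n))).re =
      Real.cos (2 * halfAngle n l * s + Real.pi * s / n) := by
    rw [← Nat.cast_add_one, ← Nat.cast_mul, re_stdAddChar_natCast, halfAngle]
    congr 1
    push_cast
    field_simp
    ring
  rw [norm_one_sub_stdAddChar_natCast (Finset.mem_range.1 hs).le, hl, hl1, Real.cos_sub,
    Real.cos_add]
  rcases Nat.eq_zero_or_pos s with rfl | hs0
  · simp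
  have : (0 : ℝ) < s := mod_cast hs0
  have hsn : (s : ℝ) < n := mod_cast Finset.mem_range.1 hs
  have hsin : Real.sin (Real.pi * s / n) ≠ 0 := by
    refine (Real.sin_pos_of_pos_of_lt_pi (by positivity) ?_).ne'
    rw [div_lt_iff₀ hn]
    gcongr
  field_simp
  ring

theorem halfAngle_pos (l : ℕ) : 0 < halfAngle n l := by
  have := NeZero.pos n
  unfold halfAngle
  positivity

theorem halfAngle_lt_pi {l : ℕ} (hl : l < n) : halfAngle n l < Real.pi := by
  have hn : (0 : ℝ) < n := mod_cast NeZero.pos n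
  have hl' : (l : ℝ) + 1 ≤ n := mod_cast hl
  rw [halfAngle, div_lt_iff₀ (by positivity), mul_comm Real.pi]
  gcongr
  linarith

theorem ringCos_sub_ringCos_add_one {l : ℕ} (hl : l < n) :
    ringCos (l : ZMod n) - ringCos ((l : ZMod n) + 1) = Real.cot (halfAngle n l) := by
  have hn : (n : ℝ) ≠ 0 := NeZero.ne _
  have hsin : Real.sin (halfAngle n l) ≠ 0 :=
    (Real.sin_pos_of_pos_of_lt_pi (halfAngle_pos l) (halfAngle_lt_pi hl)).ne'
  have hsum := two_mul_sin_half_mul_sum_range_sin (2 * halfAngle n l) n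
  have hend : 2 * halfAngle n l * n - halfAngle n l =
      Real.pi - halfAngle n l + l * (2 * Real.pi) := by
    rw [halfAngle]
    field_simp
    ring
  rw [mul_div_cancel_left₀ _ two_ne_zero, hend, Real.cos_add_nat_mul_two_pi,
    Real.cos_pi_sub] at hsum
  rw [ringCos_sub_ringCos_add_one_eq_sum_sin, Real.cot_eq_cos_div_sin, eq_div_iff hsin]
  linarith

theorem cot_halfAngle_pos {l : ℕ} (hl : 2 * l + 1 < n) : 0 < Real.cot (halfAngle n l) := by
  have hl' : (2 * l + 1 : ℝ) < n := mod_cast hl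
  have hlt : halfAngle n l < Real.pi / 2 := by
    rw [halfAngle, div_lt_div_iff₀ (by linarith) two_pos, mul_comm, ← mul_assoc, mul_comm Real.pi]
    gcongr
  rw [Real.cot_eq_cos_div_sin]
  exact div_pos (Real.cos_pos_of_mem_Ioo ⟨by linarith [halfAngle_pos (n := n) l, Real.pi_pos], hlt⟩)
    (Real.sin_pos_of_pos_of_lt_pi (halfAngle_pos l) (by linarith [Real.pi_pos]))

theorem antitoneOn_ringCos : AntitoneOn (fun l : ℕ => ringCos (l : ZMod n)) (Set.Iic (n / 2)) := by
  refine antitoneOn_of_add_one_le Set.ordConnected_Iic fun l _ _ hl => ?_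
  rw [Set.mem_Iic] at hl
  have hcot := cot_halfAngle_pos (n := n) (l := l) (by omega)
  rw [← ringCos_sub_ringCos_add_one (by omega)] at hcot
  push_cast
  linarith

theorem ringCos_le_ringCos_of_add_le {l j : ℕ} (hlj : l ≤ j) (hj : l + j ≤ n) :
    ringCos (j : ZMod n) ≤ ringCos (l : ZMod n) := by
  rcases le_or_gt j (n / 2) with h | h
  · exact antitoneOn_ringCos (Set.mem_Iic.2 (hlj.trans h)) (Set.mem_Iic.2 h) hlj
  · have hreflect : ringCos (j : ZMod n) = ringCos ((n - j : ℕ) : ZMod n) := by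
      rw [Nat.cast_sub (by omega), ZMod.natCast_self, zero_sub, ringCos_neg]
    rw [hreflect]
    exact antitoneOn_ringCos (Set.mem_Iic.2 (by omega)) (Set.mem_Iic.2 (by omega)) (by omega)

theorem ringSum_add_one_sub_eq_sum {a b : ℕ} (hab : a ≤ b) :
    ringSum ((b : ZMod n) + 1) - ringSum (b : ZMod n) =
      ringSum ((a : ZMod n) + 1) - ringSum (a : ZMod n) +
        ∑ j ∈ Finset.Ico a b, ringCos ((j + 1 : ℕ) : ZMod n) := by
  induction b, hab using Nat.le_induction with
  | base => simp
  | succ b hb ih =>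
    have hdiff := ringSum_second_difference ((b : ZMod n) + 1)
    rw [add_sub_cancel_right] at hdiff
    rw [Finset.sum_Ico_succ_top hb, Nat.cast_add_one, ← hdiff]
    linarith

theorem ringSum_one_le_add_one_sub {l : ℕ} (hl : l ≤ n / 2) (hcos : 0 ≤ ringCos (l : ZMod n)) :
    ringSum (1 : ZMod n) ≤ ringSum ((l : ZMod n) + 1) - ringSum (l : ZMod n) := by
  have hsum := ringSum_add_one_sub_eq_sum (n := n) (Nat.zero_le l)
  have hnonneg : 0 ≤ ∑ j ∈ Finset.Ico 0 l, ringCos ((j + 1 : ℕ) : ZMod n) :=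
    Finset.sum_nonneg fun j hj => hcos.trans <| by
      have := Finset.mem_Ico.1 hj
      exact ringCos_le_ringCos_of_add_le (by omega) (by omega)
  rw [Nat.cast_zero, zero_add, ringSum_zero] at hsum
  linarith

/- The increments of `ringSum` are antisymmetric about `n / 2`, and between `l` and its mirror image
all second differences are at most `ringCos l`. -/
theorem neg_ringCos_le_of_nonpos {l : ℕ} (hl : 2 * l + 2 ≤ n) (hcos : ringCos (l : ZMod n) ≤ 0) :
    -ringCos (l : ZMod n) ≤ 2 * (ringSum ((l : ZMod n) + 1) - ringSum (l : ZMod n)) := by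
  have hsum := ringSum_add_one_sub_eq_sum (n := n) (a := l) (b := n - (l + 1)) (by omega)
  have hmirror : ((n - (l + 1) : ℕ) : ZMod n) = -(l + 1) := by
    rw [Nat.cast_sub (by omega), ZMod.natCast_self, zero_sub, Nat.cast_add_one]
  rw [hmirror, ringSum_neg, neg_add, neg_add_cancel_right, ringSum_neg] at hsum
  have hle : ∑ j ∈ Finset.Ico l (n - (l + 1)), ringCos ((j + 1 : ℕ) : ZMod n) ≤
      (Finset.Ico l (n - (l + 1))).card • ringCos (l : ZMod n) :=
    Finset.sum_le_card_nsmul _ _ _ fun j hj => by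
      have := Finset.mem_Ico.1 hj
      exact ringCos_le_ringCos_of_add_le (by omega) (by omega)
  have hcard : (1 : ℝ) ≤ (n - (l + 1) - l : ℕ) := mod_cast (by omega : 1 ≤ n - (l + 1) - l)
  rw [Nat.card_Ico, nsmul_eq_mul] at hle
  linarith [mul_le_mul_of_nonpos_right hcard hcos]

theorem ringSum_lt_ringSum_add_one {l : ℕ} (hl : 2 * l + 2 ≤ n) :
    ringSum (l : ZMod n) < ringSum ((l : ZMod n) + 1) := by
  rcases le_or_gt 0 (ringCos (l : ZMod n)) with hcos | hcos
  · linarith [ringSum_one_le_add_one_sub (n := n) (by omega) hcos,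
      ringSum_one_pos (n := n) (by omega)]
  · linarith [neg_ringCos_le_of_nonpos hl hcos.le]

theorem neg_ringCos_le {l : ℕ} (hl : 2 * l + 2 ≤ n) :
    -ringCos (l : ZMod n) ≤ 2 * (ringSum ((l : ZMod n) + 1) - ringSum (l : ZMod n)) := by
  rcases le_or_gt 0 (ringCos (l : ZMod n)) with hcos | hcos
  · linarith [ringSum_lt_ringSum_add_one hl]
  · exact neg_ringCos_le_of_nonpos hl hcos.le

theorem ringSum_one_le {l : ℕ} (h1 : 1 ≤ l) (hl : 2 * l ≤ n) :
    ringSum (1 : ZMod n) ≤ ringSum (l : ZMod n) := by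
  induction l, h1 using Nat.le_induction with
  | base => rw [Nat.cast_one]
  | succ l _ ih =>
    rw [Nat.cast_add_one]
    exact (ih (by omega)).trans (ringSum_lt_ringSum_add_one (by omega)).le

/-- The slope of the affine function `m ↦ modeDet m l`, up to the factor `3 / 2`. -/
noncomputable def modeSlope (l : ZMod n) : ℝ :=
  (ringSum (l + 1) + ringSum (l - 1)) / 2 + 3 * ringSum l - ringSum (1 : ZMod n)

/-- The root of the affine function `m ↦ modeDet m l`. -/
noncomputable def modeRoot (l : ZMod n) : ℝ :=
  (3 * ringSum l - 5 * ringSum (1 : ZMod n) - (ringSum (l + 1) + ringSum (l - 1)) / 2 +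
    ((ringSum (l + 1) - ringSum (l - 1)) / 2) ^ 2 / modeSlope l) / 6

theorem modeSlope_pos {l : ℕ} (h1 : 1 ≤ l) (hl : 2 * l ≤ n) : 0 < modeSlope (l : ZMod n) := by
  rw [modeSlope]
  linarith [ringSum_one_le h1 hl, ringSum_nonneg ((l : ZMod n) + 1),
    ringSum_nonneg ((l : ZMod n) - 1), ringSum_one_pos (n := n) (by omega)]

theorem modeSlope_mul_modeRoot {l : ZMod n} (hl : modeSlope l ≠ 0) :
    modeSlope l * modeRoot l =
      (modeSlope l * (3 * ringSum l - 5 * ringSum (1 : ZMod n) -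
        (ringSum (l + 1) + ringSum (l - 1)) / 2) +
          ((ringSum (l + 1) - ringSum (l - 1)) / 2) ^ 2) / 6 := by
  rw [modeRoot]
  field_simp

theorem modeDet_eq (m : ℝ) {l : ZMod n} (hl : modeSlope l ≠ 0) :
    modeDet m l = 3 / 2 * modeSlope l * (m - modeRoot l) := by
  have hneg : ringSum (-l + 1) = ringSum (l - 1) := by
    rw [← ringSum_neg, neg_add, neg_neg, sub_eq_add_neg]
  rw [mul_sub, mul_assoc (3 / 2 : ℝ) _ (modeRoot l), modeSlope_mul_modeRoot hl, modeDet,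
    selfCoeff, selfCoeff, crossCoeff, hneg, modeSlope]
  ring

theorem modeDet_eq_zero_iff {m : ℝ} {l : ℕ} (h1 : 1 ≤ l) (hl : 2 * l ≤ n) :
    modeDet m (l : ZMod n) = 0 ↔ m = modeRoot (l : ZMod n) := by
  have hslope := (modeSlope_pos (n := n) h1 hl).ne'
  rw [modeDet_eq m hslope, mul_eq_zero, sub_eq_zero]
  simp [hslope]

/- The square in `modeRoot` is at most the square of the slope, by monotonicity of `ringSum`; the
remaining linear inequality is where the decrease of `ringCos` enters. -/
theorem modeRoot_lt_modeRoot_add_one {l : ℕ} (h1 : 1 ≤ l) (hl : 2 * (l + 1) ≤ n) :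
    modeRoot (l : ZMod n) < modeRoot ((l : ZMod n) + 1) := by
  have hslope := modeSlope_pos (n := n) h1 (by omega)
  have hslope' := modeSlope_pos (n := n) (l := l + 1) (by omega) hl
  rw [Nat.cast_add_one] at hslope'
  have hprev : ringSum ((l : ZMod n) - 1) < ringSum (l : ZMod n) := by
    have hlt := ringSum_lt_ringSum_add_one (n := n) (l := l - 1) (by omega)
    rwa [Nat.cast_sub h1, Nat.cast_one, sub_add_cancel] at hlt
  have hnext := ringSum_lt_ringSum_add_one (n := n) (l := l) (by omega)
  have hdiff := ringSum_second_difference (l : ZMod n)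
  have hdiff' := ringSum_second_difference ((l : ZMod n) + 1)
  rw [add_sub_cancel_right] at hdiff'
  have hcos : ringCos ((l : ZMod n) + 1) < ringCos (l : ZMod n) := by
    rw [← sub_pos, ringCos_sub_ringCos_add_one (by omega)]
    exact cot_halfAngle_pos (by omega)
  have hsq : ((ringSum ((l : ZMod n) + 1) - ringSum ((l : ZMod n) - 1)) / 2) ^ 2 /
      modeSlope (l : ZMod n) ≤ 2 * (ringSum ((l : ZMod n) + 1) - ringSum (l : ZMod n)) := by
    rw [div_le_iff₀ hslope, sq]
    refine mul_le_mul ?_ ?_ (by linarith) (by linarith)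
    · linarith [neg_ringCos_le (n := n) (l := l) (by omega)]
    · rw [modeSlope]
      linarith [ringSum_one_le (n := n) h1 (by omega), ringSum_nonneg ((l : ZMod n) - 1)]
  have hsq' : 0 ≤ ((ringSum ((l : ZMod n) + 1 + 1) - ringSum (l : ZMod n)) / 2) ^ 2 /
      modeSlope ((l : ZMod n) + 1) := by positivity
  rw [modeRoot, modeRoot, add_sub_cancel_right]
  linarith

theorem strictMonoOn_modeRoot :
    StrictMonoOn (fun l : ℕ => modeRoot (l : ZMod n)) (Set.Icc 1 (n / 2)) := by
  refine strictMonoOn_of_lt_add_one Set.ordConnected_Icc fun l _ hl hl' => ?_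
  rw [Set.mem_Icc] at hl hl'
  rw [Nat.cast_add_one]
  exact modeRoot_lt_modeRoot_add_one hl.1 (by omega)

theorem ringSum_two :
    ringSum (2 : ZMod n) = 4 * ringSum (1 : ZMod n) - Real.cot (halfAngle n 0) := by
  have hcot := ringCos_sub_ringCos_add_one (n := n) (l := 0) (NeZero.pos n)
  have hdiff := ringSum_second_difference (1 : ZMod n)
  norm_num [ringCos_zero, ringSum_zero] at hcot hdiff
  linarith

theorem ringSum_three (hn : 2 ≤ n) : ringSum (3 : ZMod n) =
    9 * ringSum (1 : ZMod n) - 3 * Real.cot (halfAngle n 0) - Real.cot (halfAngle n 1) := by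
  have hcot0 := ringCos_sub_ringCos_add_one (n := n) (l := 0) (by omega)
  have hcot1 := ringCos_sub_ringCos_add_one (n := n) (l := 1) (by omega)
  have hdiff := ringSum_second_difference (2 : ZMod n)
  norm_num [ringCos_zero] at hcot0 hcot1 hdiff
  linarith [ringSum_two (n := n)]

theorem ringSum_four (hn : 3 ≤ n) : ringSum (4 : ZMod n) =
    16 * ringSum (1 : ZMod n) - 6 * Real.cot (halfAngle n 0) - 3 * Real.cot (halfAngle n 1) -
      Real.cot (halfAngle n 2) := by
  have hcot0 := ringCos_sub_ringCos_add_one (n := n) (l := 0) (by omega)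
  have hcot1 := ringCos_sub_ringCos_add_one (n := n) (l := 1) (by omega)
  have hcot2 := ringCos_sub_ringCos_add_one (n := n) (l := 2) (by omega)
  have hdiff := ringSum_second_difference (3 : ZMod n)
  norm_num [ringCos_zero] at hcot0 hcot1 hcot2 hdiff
  linarith [ringSum_two (n := n), ringSum_three (n := n) (by omega)]

end ModeRoots

/-! ### Numerical enclosures -/

section Enclosures

/-- The sum of the first `k` terms of the sine series. -/
noncomputable def sinTaylor (k : ℕ) (x : ℝ) : ℝ :=
  ∑ i ∈ Finset.range k, (-1) ^ i * (x ^ (2 * i + 1) / (2 * i + 1).factorial)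

theorem antitone_pow_div_factorial {x : ℝ} (h0 : 0 ≤ x) (hx : x ^ 2 ≤ 6) :
    Antitone fun i : ℕ => x ^ (2 * i + 1) / (2 * i + 1).factorial := by
  refine antitone_nat_of_succ_le fun i => ?_
  have hfac : ((2 * (i + 1) + 1).factorial : ℝ) =
      (2 * i + 3) * (2 * i + 2) * (2 * i + 1).factorial := by
    rw [mul_add_one, add_right_comm, Nat.factorial_succ, Nat.factorial_succ]
    push_cast
    ring
  have hsq : x ^ 2 ≤ (2 * i + 3) * (2 * i + 2) := by nlinarith [(i.cast_nonneg : (0 : ℝ) ≤ i)]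
  rw [hfac, div_le_div_iff₀ (by positivity) (by positivity)]
  calc x ^ (2 * (i + 1) + 1) * (2 * i + 1).factorial
      = x ^ 2 * (x ^ (2 * i + 1) * (2 * i + 1).factorial) := by ring
    _ ≤ (2 * i + 3) * (2 * i + 2) * (x ^ (2 * i + 1) * (2 * i + 1).factorial) := by gcongr
    _ = x ^ (2 * i + 1) * ((2 * i + 3) * (2 * i + 2) * (2 * i + 1).factorial) := by ring

theorem tendsto_sinTaylor (x : ℝ) :
    Filter.Tendsto (sinTaylor · x) Filter.atTop (𝓝 (Real.sin x)) := by
  simpa only [sinTaylor, mul_div_assoc] using (Real.hasSum_sin x).tendsto_sum_nat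

theorem sinTaylor_two_mul_le_sin {x : ℝ} (h0 : 0 ≤ x) (hx : x ^ 2 ≤ 6) (k : ℕ) :
    sinTaylor (2 * k) x ≤ Real.sin x :=
  (antitone_pow_div_factorial h0 hx).alternating_series_le_tendsto (tendsto_sinTaylor x) k

theorem sin_le_sinTaylor_two_mul_add_one {x : ℝ} (h0 : 0 ≤ x) (hx : x ^ 2 ≤ 6) (k : ℕ) :
    Real.sin x ≤ sinTaylor (2 * k + 1) x :=
  (antitone_pow_div_factorial h0 hx).tendsto_le_alternating_series (tendsto_sinTaylor x) k

/-- A lower bound for `sin (π r)` when `0 ≤ r ≤ 1 / 2`, rational for rational `r`; the last term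
accounts for the error in `π ≈ 3.1416`. -/
noncomputable def sinLower (r : ℝ) : ℝ := sinTaylor 6 (3.1416 * r) - r / 10 ^ 5

/-- An upper bound for `sin (π r)` when `0 ≤ r ≤ 1 / 2`, rational for rational `r`; the last term
accounts for the error in `π ≈ 3.1416`. -/
noncomputable def sinUpper (r : ℝ) : ℝ := sinTaylor 5 (3.1416 * r) + r / 10 ^ 5

theorem abs_sin_pi_mul_sub_le {r : ℝ} (hr : 0 ≤ r) :
    |Real.sin (Real.pi * r) - Real.sin (3.1416 * r)| ≤ r / 10 ^ 5 := by
  have hpi : |Real.pi - 3.1416| ≤ 1 / 10 ^ 5 :=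
    abs_sub_le_iff.2 ⟨by linarith [Real.pi_lt_d4], by linarith [Real.pi_gt_d6]⟩
  calc |Real.sin (Real.pi * r) - Real.sin (3.1416 * r)|
      ≤ |Real.pi * r - 3.1416 * r| := Real.abs_sin_sub_sin_le _ _
    _ = |Real.pi - 3.1416| * r := by rw [← sub_mul, abs_mul, abs_of_nonneg hr]
    _ ≤ 1 / 10 ^ 5 * r := by gcongr
    _ = r / 10 ^ 5 := by ring

theorem sinLower_le_sin {r : ℝ} (h0 : 0 ≤ r) (h1 : r ≤ 1 / 2) :
    sinLower r ≤ Real.sin (Real.pi * r) := by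
  have htaylor : sinTaylor 6 (3.1416 * r) ≤ Real.sin (3.1416 * r) :=
    sinTaylor_two_mul_le_sin (by positivity) (by nlinarith) 3
  rw [sinLower]
  linarith [(abs_le.1 (abs_sin_pi_mul_sub_le h0)).1]

theorem sin_le_sinUpper {r : ℝ} (h0 : 0 ≤ r) (h1 : r ≤ 1 / 2) :
    Real.sin (Real.pi * r) ≤ sinUpper r := by
  have htaylor : Real.sin (3.1416 * r) ≤ sinTaylor 5 (3.1416 * r) :=
    sin_le_sinTaylor_two_mul_add_one (by positivity) (by nlinarith) 2
  rw [sinUpper]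
  linarith [(abs_le.1 (abs_sin_pi_mul_sub_le h0)).2]

theorem sinLower_eq (r : ℝ) : sinLower r = r * (3.1416 * (1 - (3.1416 * r) ^ 2 / 6 *
    (1 - (3.1416 * r) ^ 2 / 20 * (1 - (3.1416 * r) ^ 2 / 42 * (1 - (3.1416 * r) ^ 2 / 72 *
      (1 - (3.1416 * r) ^ 2 / 110))))) - 1 / 10 ^ 5) := by
  simp only [sinLower, sinTaylor, Finset.sum_range_succ, Finset.sum_range_zero, Nat.factorial]
  norm_num
  ring

theorem sinUpper_eq (r : ℝ) : sinUpper r = r * (3.1416 * (1 - (3.1416 * r) ^ 2 / 6 *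
    (1 - (3.1416 * r) ^ 2 / 20 * (1 - (3.1416 * r) ^ 2 / 42 * (1 - (3.1416 * r) ^ 2 / 72)))) +
      1 / 10 ^ 5) := by
  simp only [sinUpper, sinTaylor, Finset.sum_range_succ, Finset.sum_range_zero, Nat.factorial]
  norm_num
  ring

theorem sinLower_pos {r : ℝ} (h0 : 0 < r) (h1 : r ≤ 1 / 2) : 0 < sinLower r := by
  rw [sinLower_eq]
  have hy : (3.1416 * r) ^ 2 ∈ Set.Icc 0 (5 / 2) := ⟨by positivity, by nlinarith⟩
  generalize (3.1416 * r) ^ 2 = y at hy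
  have hfactor : ∀ {c t : ℝ}, 5 / 2 ≤ c → t ∈ Set.Icc 0 1 → 1 - y / c * t ∈ Set.Icc 0 1 := by
    intro c t hc ht
    have hdiv : y / c ∈ Set.Icc 0 1 :=
      ⟨div_nonneg hy.1 (by linarith), div_le_one_of_le₀ (hy.2.trans hc) (by linarith)⟩
    have hmul := unitInterval.mul_mem hdiv ht
    exact ⟨sub_nonneg.2 hmul.2, sub_le_self _ hmul.1⟩
  have hlast : 1 - y / 110 ∈ Set.Icc 0 1 := by
    constructor <;> linarith [hy.1, hy.2]
  have hrest := hfactor (c := 20) (by norm_num) <| hfactor (c := 42) (by norm_num) <|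
    hfactor (c := 72) (by norm_num) hlast
  refine mul_pos h0 ?_
  linarith [mul_le_mul hy.2 hrest.2 hrest.1 (by norm_num : (0 : ℝ) ≤ 5 / 2)]

theorem sinLower_nonneg {r : ℝ} (h0 : 0 ≤ r) (h1 : r ≤ 1 / 2) : 0 ≤ sinLower r := by
  rcases h0.eq_or_lt with rfl | h0
  · simp [sinLower, sinTaylor]
  · exact (sinLower_pos h0 h1).le

variable {n : ℕ}

theorem sin_pi_mul_reflect_div {s : ℕ} (hs : s ≤ n) :
    Real.sin (Real.pi * (n - s : ℕ) / n) = Real.sin (Real.pi * s / n) := by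
  rcases n.eq_zero_or_pos with rfl | hn
  · simp
  · have : (0 : ℝ) < n := mod_cast hn
    rw [← Real.sin_pi_sub, Nat.cast_sub hs]
    congr 1
    field_simp
    ring

theorem sin_pi_mul_min_div {s : ℕ} (hs : s ≤ n) :
    Real.sin (Real.pi * (min s (n - s) : ℕ) / n) = Real.sin (Real.pi * s / n) := by
  rcases min_choice s (n - s) with h | h <;> rw [h]
  exact sin_pi_mul_reflect_div hs

theorem min_div_le_half (n s : ℕ) : ((min s (n - s) : ℕ) : ℝ) / n ≤ 1 / 2 := by
  have hmin : ((2 * min s (n - s) : ℕ) : ℝ) ≤ n := mod_cast (by omega : 2 * min s (n - s) ≤ n)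
  push_cast at hmin ⊢
  exact div_le_of_le_mul₀ n.cast_nonneg (by norm_num) (by linarith)

/-- A rational lower bound for `ringSum (1 : ZMod n)`. Angles beyond `π / 2` are reflected, and the
term `s = 0` is `0⁻¹ = 0`. -/
noncomputable def ringSumLower (n : ℕ) : ℝ :=
  ∑ s ∈ Finset.range n, (sinUpper ((min s (n - s) : ℕ) / n))⁻¹ / 4

/-- A rational upper bound for `ringSum (1 : ZMod n)`. Angles beyond `π / 2` are reflected, and the
term `s = 0` is `0⁻¹ = 0`. -/
noncomputable def ringSumUpper (n : ℕ) : ℝ :=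
  ∑ s ∈ Finset.range n, (sinLower ((min s (n - s) : ℕ) / n))⁻¹ / 4

theorem inv_sin_mem_Icc {s : ℕ} (hs : s < n) : (Real.sin (Real.pi * s / n))⁻¹ ∈
    Set.Icc (sinUpper ((min s (n - s) : ℕ) / n))⁻¹ (sinLower ((min s (n - s) : ℕ) / n))⁻¹ := by
  rcases s.eq_zero_or_pos with rfl | hs0
  · simp [sinUpper, sinLower, sinTaylor]
  have hn : (0 : ℝ) < n := mod_cast hs0.trans hs
  have hmin : (0 : ℝ) < (min s (n - s) : ℕ) := mod_cast lt_min hs0 (Nat.sub_pos_of_lt hs)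
  have hpos := sinLower_pos (div_pos hmin hn) (min_div_le_half n s)
  have hlower := sinLower_le_sin (div_pos hmin hn).le (min_div_le_half n s)
  have hupper := sin_le_sinUpper (div_pos hmin hn).le (min_div_le_half n s)
  rw [← sin_pi_mul_min_div hs.le, mul_div_assoc]
  exact ⟨inv_anti₀ (hpos.trans_le hlower) hupper, inv_anti₀ hpos hlower⟩

theorem ringSumLower_le [NeZero n] : ringSumLower n ≤ ringSum (1 : ZMod n) := by
  rw [ringSum_one_eq_sum_range, ringSumLower]
  exact Finset.sum_le_sum fun s hs =>
    div_le_div_of_nonneg_right (inv_sin_mem_Icc (Finset.mem_range.1 hs)).1 (by norm_num)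

theorem ringSum_one_le_ringSumUpper [NeZero n] : ringSum (1 : ZMod n) ≤ ringSumUpper n := by
  rw [ringSum_one_eq_sum_range, ringSumUpper]
  exact Finset.sum_le_sum fun s hs =>
    div_le_div_of_nonneg_right (inv_sin_mem_Icc (Finset.mem_range.1 hs)).2 (by norm_num)

theorem ringSumLower_nonneg (n : ℕ) : 0 ≤ ringSumLower n := by
  refine Finset.sum_nonneg fun s _ => ?_
  have hsin : 0 ≤ sinUpper ((min s (n - s) : ℕ) / n) :=
    (sinLower_nonneg (by positivity) (min_div_le_half n s)).trans <|
      (sinLower_le_sin (by positivity) (min_div_le_half n s)).trans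
        (sin_le_sinUpper (by positivity) (min_div_le_half n s))
  positivity

/-- A rational lower bound for `cot (halfAngle n l)`. -/
noncomputable def cotLower (n l : ℕ) : ℝ :=
  sinLower (1 / 2 - (2 * l + 1) / (2 * n)) / sinUpper ((2 * l + 1) / (2 * n))

/-- A rational upper bound for `cot (halfAngle n l)`. -/
noncomputable def cotUpper (n l : ℕ) : ℝ :=
  sinUpper (1 / 2 - (2 * l + 1) / (2 * n)) / sinLower ((2 * l + 1) / (2 * n))

theorem cot_pi_mul (r : ℝ) : Real.cot (Real.pi * r) =
    Real.sin (Real.pi * (1 / 2 - r)) / Real.sin (Real.pi * r) := by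
  rw [Real.cot_eq_cos_div_sin, ← Real.sin_pi_div_two_sub, mul_sub, mul_one_div]

theorem halfAngle_ratio_mem_Ioc {l : ℕ} (hl : 2 * l + 1 ≤ n) :
    (2 * l + 1 : ℝ) / (2 * n) ∈ Set.Ioc 0 (1 / 2) := by
  have hn : (0 : ℝ) < n := mod_cast (Nat.succ_pos _).trans_le hl
  have hl' : (2 * l + 1 : ℝ) ≤ n := mod_cast hl
  refine ⟨by positivity, ?_⟩
  rw [div_le_div_iff₀ (by positivity) two_pos]
  linarith

theorem cot_halfAngle_mem_Icc {l : ℕ} (hl : 2 * l + 1 ≤ n) :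
    Real.cot (halfAngle n l) ∈ Set.Icc (cotLower n l) (cotUpper n l) := by
  have hangle : halfAngle n l = Real.pi * ((2 * l + 1) / (2 * n)) := by
    rw [halfAngle]
    ring
  obtain ⟨hr0, hr1⟩ := halfAngle_ratio_mem_Ioc hl
  rw [hangle, cot_pi_mul, cotLower, cotUpper]
  generalize (2 * l + 1 : ℝ) / (2 * n) = r at hr0 hr1
  have hpos := sinLower_pos hr0 hr1
  have hlower := sinLower_le_sin hr0.le hr1
  have hnonneg := sinLower_nonneg (sub_nonneg.2 hr1) (by linarith)
  have hlower' := sinLower_le_sin (sub_nonneg.2 hr1) (by linarith)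
  have hupper' := sin_le_sinUpper (sub_nonneg.2 hr1) (by linarith)
  constructor
  · exact div_le_div₀ (hnonneg.trans hlower') hlower' (hpos.trans_le hlower)
      (sin_le_sinUpper hr0.le hr1)
  · exact div_le_div₀ ((hnonneg.trans hlower').trans hupper') hupper' hpos hlower

theorem cotLower_nonneg {l : ℕ} (hl : 2 * l + 1 ≤ n) : 0 ≤ cotLower n l := by
  obtain ⟨hr0, hr1⟩ := halfAngle_ratio_mem_Ioc hl
  exact div_nonneg (sinLower_nonneg (sub_nonneg.2 hr1) (by linarith)) <|
    (sinLower_nonneg hr0.le hr1).trans <|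
      (sinLower_le_sin hr0.le hr1).trans (sin_le_sinUpper hr0.le hr1)

end Enclosures

/-! ### Signs of the first, second and third modes -/

section ModeSigns

variable {n : ℕ} [NeZero n]

/-- The slope of the affine function `m ↦ firstModeDet n m`, up to the factor `3 / 4`. -/
noncomputable def firstModeSlope (n : ℕ) [NeZero n] : ℝ :=
  8 * ringSum (1 : ZMod n) - Real.cot (halfAngle n 0) - 2 * n

/-- Twice the product of `modeSlope 2` and `modeRoot 2`; it has the sign of `modeRoot 2`. -/
noncomputable def secondModeForm (n : ℕ) [NeZero n] : ℝ :=
  16 * ringSum (1 : ZMod n) ^ 2 - 15 * ringSum (1 : ZMod n) * Real.cot (halfAngle n 0) +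
    3 * Real.cot (halfAngle n 0) ^ 2 + ringSum (1 : ZMod n) * Real.cot (halfAngle n 1)

/-- Six times the part of `modeRoot 3` outside the square, hence a lower bound for
`6 * modeRoot 3`. -/
noncomputable def thirdModeForm (n : ℕ) [NeZero n] : ℝ :=
  12 * ringSum (1 : ZMod n) - 11 / 2 * Real.cot (halfAngle n 0) -
    3 / 2 * Real.cot (halfAngle n 1) + Real.cot (halfAngle n 2) / 2

/-- The value of `firstModeDet n` at `m = 0`. -/
noncomputable def firstModeConst (n : ℕ) [NeZero n] : ℝ :=
  (3 * ringSum (1 : ZMod n) - Real.cot (halfAngle n 0) / 2) * (n / 2 + ringSum (1 : ZMod n))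

theorem firstModeDet_eq (m : ℝ) :
    firstModeDet n m = 3 / 4 * firstModeSlope n * m + firstModeConst n := by
  rw [firstModeDet, selfCoeff, one_add_one_eq_two, ringSum_two, firstModeSlope, firstModeConst]
  ring

theorem firstModeConst_pos (hn : 2 ≤ n) : 0 < firstModeConst n := by
  have hone := ringSum_one_pos (n := n) hn
  have htwo := ringSum_nonneg (2 : ZMod n)
  rw [ringSum_two] at htwo
  exact mul_pos (by linarith) (by positivity)

theorem two_mul_modeSlope_two_mul_modeRoot_two (hn : 4 ≤ n) :
    2 * (modeSlope (2 : ZMod n) * modeRoot (2 : ZMod n)) = secondModeForm n := by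
  have hslope : modeSlope (2 : ZMod n) ≠ 0 :=
    (modeSlope_pos (n := n) (l := 2) one_le_two hn).ne'
  have hthree : (2 + 1 : ZMod n) = 3 := by norm_num
  have hone : (2 - 1 : ZMod n) = 1 := by norm_num
  rw [modeSlope_mul_modeRoot hslope, modeSlope, hthree, hone, ringSum_two,
    ringSum_three (by omega), secondModeForm]
  ring

theorem modeRoot_two_pos_iff (hn : 4 ≤ n) :
    0 < modeRoot (2 : ZMod n) ↔ 0 < secondModeForm n := by
  have hslope : 0 < modeSlope (2 : ZMod n) := modeSlope_pos (n := n) (l := 2) one_le_two hn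
  rw [← two_mul_modeSlope_two_mul_modeRoot_two hn, mul_pos_iff_of_pos_left two_pos,
    mul_pos_iff_of_pos_left hslope]

theorem modeRoot_three_eq (hn : 3 ≤ n) : modeRoot (3 : ZMod n) = (thirdModeForm n +
    ((ringSum (4 : ZMod n) - ringSum (2 : ZMod n)) / 2) ^ 2 / modeSlope (3 : ZMod n)) / 6 := by
  have hfour : (3 + 1 : ZMod n) = 4 := by norm_num
  have htwo : (3 - 1 : ZMod n) = 2 := by norm_num
  rw [modeRoot, hfour, htwo, thirdModeForm, ringSum_three (by omega), ringSum_four hn, ringSum_two]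
  ring

theorem modeRoot_three_pos (hn : 6 ≤ n) (h : 0 < thirdModeForm n) :
    0 < modeRoot (3 : ZMod n) := by
  have hslope : 0 < modeSlope (3 : ZMod n) :=
    modeSlope_pos (n := n) (l := 3) (by norm_num) hn
  rw [modeRoot_three_eq (by omega)]
  positivity

theorem secondModeForm_le (hn : 4 ≤ n) : secondModeForm n ≤
    16 * ringSumUpper n ^ 2 - 15 * (ringSumLower n * cotLower n 0) + 3 * cotUpper n 0 ^ 2 +
      ringSumUpper n * cotUpper n 1 := by
  have hS := ringSum_nonneg (1 : ZMod n)
  have hcot0 := cot_halfAngle_pos (n := n) (l := 0) (by omega)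
  have hcot1 := cot_halfAngle_pos (n := n) (l := 1) (by omega)
  have hmul : ringSumLower n * cotLower n 0 ≤ ringSum (1 : ZMod n) * Real.cot (halfAngle n 0) :=
    mul_le_mul ringSumLower_le (cot_halfAngle_mem_Icc (by omega)).1
      (cotLower_nonneg (by omega)) hS
  rw [secondModeForm, mul_assoc 15]
  gcongr
  · exact ringSum_one_le_ringSumUpper
  · exact (cot_halfAngle_mem_Icc (by omega)).2
  · exact hS.trans ringSum_one_le_ringSumUpper
  · exact ringSum_one_le_ringSumUpper
  · exact (cot_halfAngle_mem_Icc (by omega)).2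

theorem le_secondModeForm (hn : 4 ≤ n) :
    16 * ringSumLower n ^ 2 - 15 * (ringSumUpper n * cotUpper n 0) + 3 * cotLower n 0 ^ 2 +
      ringSumLower n * cotLower n 1 ≤ secondModeForm n := by
  have hS := ringSum_nonneg (1 : ZMod n)
  have hSlower := ringSumLower_nonneg n
  have hcot0 := cot_halfAngle_pos (n := n) (l := 0) (by omega)
  have hcotLower0 : 0 ≤ cotLower n 0 := cotLower_nonneg (by omega)
  have hcotLower1 : 0 ≤ cotLower n 1 := cotLower_nonneg (by omega)
  rw [secondModeForm, mul_assoc 15]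
  gcongr
  · exact ringSumLower_le
  · exact hS.trans ringSum_one_le_ringSumUpper
  · exact ringSum_one_le_ringSumUpper
  · exact (cot_halfAngle_mem_Icc (by omega)).2
  · exact (cot_halfAngle_mem_Icc (by omega)).1
  · exact ringSumLower_le
  · exact (cot_halfAngle_mem_Icc (by omega)).1

theorem firstModeSlope_neg (h3 : 3 ≤ n) (h6 : n ≤ 6) : firstModeSlope n < 0 := by
  have hnum : 8 * ringSumUpper n - cotLower n 0 - 2 * n < 0 := by
    simp only [ringSumUpper, cotLower]
    interval_cases n <;> simp only [Finset.sum_range_succ, Finset.sum_range_zero] <;>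
      norm_num [sinLower_eq, sinUpper_eq]
  rw [firstModeSlope]
  linarith [ringSum_one_le_ringSumUpper (n := n),
    (cot_halfAngle_mem_Icc (n := n) (l := 0) (by omega)).1]

theorem firstModeSlope_pos_of_le (h7 : 7 ≤ n) (h12 : n ≤ 12) : 0 < firstModeSlope n := by
  have hnum : 0 < 8 * ringSumLower n - cotUpper n 0 - 2 * n := by
    simp only [ringSumLower, cotUpper]
    interval_cases n <;> simp only [Finset.sum_range_succ, Finset.sum_range_zero] <;>
      norm_num [sinLower_eq, sinUpper_eq]
  rw [firstModeSlope]
  linarith [ringSumLower_le (n := n), (cot_halfAngle_mem_Icc (n := n) (l := 0) (by omega)).2]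

theorem secondModeForm_nonpos (h4 : 4 ≤ n) (h9 : n ≤ 9) : secondModeForm n ≤ 0 := by
  refine (secondModeForm_le (by omega)).trans ?_
  simp only [ringSumLower, ringSumUpper, cotLower, cotUpper]
  interval_cases n <;> simp only [Finset.sum_range_succ, Finset.sum_range_zero] <;>
    norm_num [sinLower_eq, sinUpper_eq]

theorem secondModeForm_pos_of_le (h10 : 10 ≤ n) (h12 : n ≤ 12) : 0 < secondModeForm n := by
  refine lt_of_lt_of_le ?_ (le_secondModeForm (by omega))
  simp only [ringSumLower, ringSumUpper, cotLower, cotUpper]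
  interval_cases n <;> simp only [Finset.sum_range_succ, Finset.sum_range_zero] <;>
    norm_num [sinLower_eq, sinUpper_eq]

theorem thirdModeForm_pos (h6 : 6 ≤ n) (h9 : n ≤ 9) : 0 < thirdModeForm n := by
  have hnum : 0 < 12 * ringSumLower n - 11 / 2 * cotUpper n 0 - 3 / 2 * cotUpper n 1 +
      cotLower n 2 / 2 := by
    simp only [ringSumLower, cotLower, cotUpper]
    interval_cases n <;> simp only [Finset.sum_range_succ, Finset.sum_range_zero] <;>
      norm_num [sinLower_eq, sinUpper_eq]
  rw [thirdModeForm]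
  linarith [ringSumLower_le (n := n), (cot_halfAngle_mem_Icc (n := n) (l := 0) (by omega)).2,
    (cot_halfAngle_mem_Icc (n := n) (l := 1) (by omega)).2,
    (cot_halfAngle_mem_Icc (n := n) (l := 2) (by omega)).1]

end ModeSigns
/-! ### Large polygons -/

section LargePolygons

variable {n : ℕ}

theorem two_mul_sum_Icc_le_sum_range {f : ℕ → ℝ} {k : ℕ} (hk : 2 * k < n)
    (hnonneg : ∀ s < n, 0 ≤ f s) (hf : ∀ s ≤ n, f (n - s) = f s) :
    2 * ∑ s ∈ Finset.Icc 1 k, f s ≤ ∑ s ∈ Finset.range n, f s := by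
  have hreflect : ∑ s ∈ Finset.Ico (n - k) n, f s = ∑ s ∈ Finset.Icc 1 k, f s := by
    rw [← Finset.Ico_add_one_right_eq_Icc, ← Finset.sum_congr rfl fun s hs => hf s
      (by have := Finset.mem_Ico.1 hs; omega), Finset.sum_Ico_reflect f (n - k) n.le_succ]
    congr 2 <;> omega
  have hdisj : Disjoint (Finset.Icc 1 k) (Finset.Ico (n - k) n) :=
    Finset.disjoint_left.2 fun s hs hs' => by
      rw [Finset.mem_Icc] at hs
      rw [Finset.mem_Ico] at hs'
      omega
  calc 2 * ∑ s ∈ Finset.Icc 1 k, f s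
      = ∑ s ∈ Finset.Icc 1 k ∪ Finset.Ico (n - k) n, f s := by
        rw [Finset.sum_union hdisj, hreflect, two_mul]
    _ ≤ ∑ s ∈ Finset.range n, f s := by
        refine Finset.sum_le_sum_of_subset_of_nonneg (fun s hs => ?_) fun s hs _ =>
          hnonneg s (Finset.mem_range.1 hs)
        rw [Finset.mem_union, Finset.mem_Icc, Finset.mem_Ico] at hs
        rw [Finset.mem_range]
        omega

theorem cot_le_inv {x : ℝ} (h0 : 0 < x) (h1 : x < Real.pi / 2) : Real.cot x ≤ x⁻¹ := by
  rw [← inv_inv (Real.cot x), Real.cot_inv_eq_tan]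
  exact inv_anti₀ h0 (Real.lt_tan h0 h1).le

theorem inv_sub_half_le_cot {x : ℝ} (h0 : 0 < x) (h1 : x ≤ Real.pi / 2) :
    x⁻¹ - x / 2 ≤ Real.cot x := by
  have hsin : 0 < Real.sin x := Real.sin_pos_of_pos_of_lt_pi h0 (by linarith [Real.pi_pos])
  have hcos : 0 ≤ Real.cos x :=
    Real.cos_nonneg_of_mem_Icc ⟨by linarith, h1⟩
  calc x⁻¹ - x / 2 = (1 - x ^ 2 / 2) / x := by field_simp
    _ ≤ Real.cos x / Real.sin x :=
        div_le_div₀ hcos Real.one_sub_sq_div_two_le_cos hsin (Real.sin_le h0.le)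
    _ = Real.cot x := (Real.cot_eq_cos_div_sin x).symm

theorem halfAngle_zero_eq : halfAngle n 0 = Real.pi / (2 * n) := by
  rw [halfAngle, Nat.cast_zero, mul_zero, zero_add, one_mul]

theorem halfAngle_zero_le (hn : 13 ≤ n) : halfAngle n 0 ≤ 0.121 := by
  have hn' : (13 : ℝ) ≤ n := mod_cast hn
  rw [halfAngle_zero_eq, div_le_iff₀ (by positivity)]
  linarith [Real.pi_lt_d4]

variable [NeZero n]

theorem harmonic_div_halfAngle_le_ringSum_one {k : ℕ} (hk : 2 * k < n) :
    harmonic k / (4 * halfAngle n 0) ≤ ringSum (1 : ZMod n) := by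
  have hterm : ∀ s ∈ Finset.Icc 1 k,
      (s : ℝ)⁻¹ / (8 * halfAngle n 0) ≤ (Real.sin (Real.pi * s / n))⁻¹ / 4 := by
    intro s hs
    rw [Finset.mem_Icc] at hs
    have hs0 : (0 : ℝ) < s := mod_cast hs.1
    have hn : (0 : ℝ) < n := mod_cast NeZero.pos n
    have hsin : 0 < Real.sin (Real.pi * s / n) := by
      refine Real.sin_pos_of_pos_of_lt_pi (by positivity) ?_
      rw [div_lt_iff₀ hn]
      gcongr
      omega
    calc (s : ℝ)⁻¹ / (8 * halfAngle n 0) = (Real.pi * s / n)⁻¹ / 4 := by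
          rw [halfAngle_zero_eq]
          field_simp
          ring
      _ ≤ (Real.sin (Real.pi * s / n))⁻¹ / 4 := by
          gcongr
          exact Real.sin_le (by positivity)
  calc harmonic k / (4 * halfAngle n 0)
      = 2 * ∑ s ∈ Finset.Icc 1 k, (s : ℝ)⁻¹ / (8 * halfAngle n 0) := by
        rw [harmonic_eq_sum_Icc, ← Finset.sum_div]
        push_cast
        ring
    _ ≤ 2 * ∑ s ∈ Finset.Icc 1 k, (Real.sin (Real.pi * s / n))⁻¹ / 4 :=
        mul_le_mul_of_nonneg_left (Finset.sum_le_sum hterm) zero_le_two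
    _ ≤ ∑ s ∈ Finset.range n, (Real.sin (Real.pi * s / n))⁻¹ / 4 :=
        two_mul_sum_Icc_le_sum_range hk
          (fun s hs => div_nonneg (inv_nonneg.2 (sin_pi_mul_div_nonneg hs.le)) (by norm_num))
          (fun s hs => by rw [sin_pi_mul_reflect_div hs])
    _ = ringSum (1 : ZMod n) := ringSum_one_eq_sum_range.symm

theorem cot_halfAngle_zero_le (hn : 13 ≤ n) : Real.cot (halfAngle n 0) ≤ (halfAngle n 0)⁻¹ :=
  cot_le_inv (halfAngle_pos 0) (by linarith [halfAngle_zero_le hn, Real.pi_gt_three])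

theorem mul_inv_halfAngle_le_ringSum_one (hn : 13 ≤ n) :
    0.6125 * (halfAngle n 0)⁻¹ ≤ ringSum (1 : ZMod n) := by
  have hharmonic : ((harmonic 6 : ℚ) : ℝ) = 2.45 := by
    norm_num [harmonic, Finset.sum_range_succ]
  calc 0.6125 * (halfAngle n 0)⁻¹ = harmonic 6 / (4 * halfAngle n 0) := by
        rw [hharmonic]
        field_simp
        norm_num
    _ ≤ ringSum (1 : ZMod n) := harmonic_div_halfAngle_le_ringSum_one (by omega)

theorem mul_cot_halfAngle_zero_le_cot_halfAngle_one (hn : 13 ≤ n) :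
    0.311 * Real.cot (halfAngle n 0) ≤ Real.cot (halfAngle n 1) := by
  have hone : halfAngle n 1 = 3 * halfAngle n 0 := by
    rw [halfAngle, halfAngle]
    push_cast
    ring
  have hx0 := halfAngle_pos (n := n) 0
  have hx := halfAngle_zero_le hn
  have hcot := cot_halfAngle_zero_le hn
  have hcot' := inv_sub_half_le_cot (x := 3 * halfAngle n 0) (by positivity)
    (by linarith [Real.pi_gt_three])
  have hsq : halfAngle n 0 ≤ 0.014641 * (halfAngle n 0)⁻¹ := by
    rw [← div_eq_mul_inv, le_div_iff₀ hx0]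
    nlinarith
  rw [mul_inv] at hcot'
  rw [hone]
  linarith

theorem firstModeSlope_pos (hn : 7 ≤ n) : 0 < firstModeSlope n := by
  rcases le_or_gt n 12 with h12 | h12
  · exact firstModeSlope_pos_of_le hn h12
  have hsum := mul_inv_halfAngle_le_ringSum_one (n := n) h12
  have hcot := cot_halfAngle_zero_le (n := n) h12
  have hn' : 2 * (n : ℝ) = Real.pi * (halfAngle n 0)⁻¹ := by
    rw [halfAngle_zero_eq]
    field_simp
  have hinv : 0 < (halfAngle n 0)⁻¹ := inv_pos.2 (halfAngle_pos 0)
  have hpi : Real.pi * (halfAngle n 0)⁻¹ < 3.15 * (halfAngle n 0)⁻¹ := by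
    gcongr
    exact Real.pi_lt_d2
  rw [firstModeSlope, hn']
  linarith

theorem secondModeForm_pos (hn : 10 ≤ n) : 0 < secondModeForm n := by
  rcases le_or_gt n 12 with h12 | h12
  · exact secondModeForm_pos_of_le hn h12
  have hcot := cot_halfAngle_pos (n := n) (l := 0) (by omega)
  have hcot' := mul_cot_halfAngle_zero_le_cot_halfAngle_one (n := n) h12
  have hsum : 0.6125 * Real.cot (halfAngle n 0) ≤ ringSum (1 : ZMod n) := by
    linarith [mul_inv_halfAngle_le_ringSum_one (n := n) h12,
      cot_halfAngle_zero_le (n := n) h12]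
  rw [secondModeForm]
  generalize ringSum (1 : ZMod n) = S at *
  generalize Real.cot (halfAngle n 0) = c at *
  -- The form is at least `16 S² - 14.689 S c + 3 c²`, which this product bounds from below.
  have hfactor : 0 ≤ (S - 0.6125 * c) * (16 * S - 4.889 * c) :=
    mul_nonneg (by linarith) (by linarith)
  have hmul : S * (0.311 * c) ≤ S * Real.cot (halfAngle n 1) :=
    mul_le_mul_of_nonneg_left hcot' (by linarith)
  nlinarith [pow_pos hcot 2]

end LargePolygons

/-! ### Counting the degeneracy values -/

section Counting

variable {n : ℕ} [NeZero n]

theorem mem_degeneracyValues_iff (hn : 3 ≤ n) {m : ℝ} : m ∈ degeneracyValues n ↔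
    0 < m ∧ (firstModeDet n m = 0 ∨ ∃ l : ℕ, 2 ≤ l ∧ l ≤ n / 2 ∧ m = modeRoot (l : ZMod n)) := by
  refine and_congr_right fun hm => ?_
  rw [isDegenerate_iff_modeDet hn hm]
  refine or_congr_right <| exists_congr fun l => and_congr_right fun h2 =>
    and_congr_right fun hl => ?_
  exact modeDet_eq_zero_iff (by omega) (by omega)

theorem degeneracyValues_eq_union (hn : 3 ≤ n) {a : ℕ} (ha : 2 ≤ a)
    (hpos : ∀ l ∈ Set.Icc 2 (n / 2), 0 < modeRoot (l : ZMod n) ↔ a ≤ l) :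
    degeneracyValues n = {m | 0 < m ∧ firstModeDet n m = 0} ∪
      (fun l : ℕ => modeRoot (l : ZMod n)) '' Set.Icc a (n / 2) := by
  ext m
  rw [mem_degeneracyValues_iff hn, and_or_left]
  refine or_congr_right ⟨?_, ?_⟩
  · rintro ⟨hm, l, h2, hl, rfl⟩
    exact ⟨l, ⟨(hpos l ⟨h2, hl⟩).1 hm, hl⟩, rfl⟩
  · rintro ⟨l, ⟨hal, hl⟩, rfl⟩
    exact ⟨(hpos l ⟨ha.trans hal, hl⟩).2 hal, l, ha.trans hal, hl, rfl⟩

theorem encard_modeRoot_image {a : ℕ} (ha : 1 ≤ a) :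
    ((fun l : ℕ => modeRoot (l : ZMod n)) '' Set.Icc a (n / 2)).encard =
      ((n / 2 + 1 - a : ℕ) : ℕ∞) := by
  rw [(strictMonoOn_modeRoot.injOn.mono (Set.Icc_subset_Icc_left ha)).encard_image,
    ← Finset.coe_Icc, Set.encard_coe_eq_coe_finsetCard, Nat.card_Icc]

theorem modeRoot_pos (hn : 10 ≤ n) {l : ℕ} (hl : l ∈ Set.Icc 2 (n / 2)) :
    0 < modeRoot (l : ZMod n) :=
  calc 0 < modeRoot (2 : ZMod n) := (modeRoot_two_pos_iff (by omega)).2 (secondModeForm_pos hn)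
    _ = modeRoot ((2 : ℕ) : ZMod n) := by rw [Nat.cast_ofNat]
    _ ≤ modeRoot (l : ZMod n) := strictMonoOn_modeRoot.monotoneOn
      ⟨one_le_two, by omega⟩ ⟨one_le_two.trans hl.1, hl.2⟩ hl.1

theorem modeRoot_pos_iff_three_le (hn : n ≤ 9) {l : ℕ} (hl : l ∈ Set.Icc 2 (n / 2)) :
    0 < modeRoot (l : ZMod n) ↔ 3 ≤ l := by
  obtain ⟨h2, hl⟩ := hl
  constructor
  · intro hpos
    by_contra! h3
    obtain rfl : l = 2 := by omega
    rw [Nat.cast_ofNat, modeRoot_two_pos_iff (by omega)] at hpos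
    exact (secondModeForm_nonpos (by omega) hn).not_gt hpos
  · intro h3
    calc 0 < modeRoot (3 : ZMod n) :=
        modeRoot_three_pos (by omega) (thirdModeForm_pos (by omega) hn)
      _ = modeRoot ((3 : ℕ) : ZMod n) := by rw [Nat.cast_ofNat]
      _ ≤ modeRoot (l : ZMod n) := strictMonoOn_modeRoot.monotoneOn
        ⟨by norm_num, h3.trans hl⟩ ⟨one_le_two.trans h2, hl⟩ h3

theorem setOf_firstModeDet_eq_zero_of_slope_pos (hn : 2 ≤ n) (hslope : 0 < firstModeSlope n) :
    {m | 0 < m ∧ firstModeDet n m = 0} = ∅ := by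
  refine Set.eq_empty_of_forall_notMem fun m ⟨hm, hdet⟩ => hdet.not_gt ?_
  rw [firstModeDet_eq]
  have hconst := firstModeConst_pos hn
  positivity

theorem setOf_firstModeDet_eq_zero_of_slope_neg (hn : 2 ≤ n) (hslope : firstModeSlope n < 0) :
    {m | 0 < m ∧ firstModeDet n m = 0} = {firstModeConst n / (-(3 / 4) * firstModeSlope n)} := by
  have hden : 0 < -(3 / 4) * firstModeSlope n := by linarith
  ext m
  rw [Set.mem_ofPred_eq, Set.mem_singleton_iff, eq_div_iff hden.ne', firstModeDet_eq]
  constructor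
  · rintro ⟨-, hdet⟩
    linarith
  · intro hm
    exact ⟨pos_of_mul_pos_left (hm ▸ firstModeConst_pos hn) hden.le, by linarith⟩

theorem encard_degeneracyValues_of_modeRoot_pos_iff (hn : 7 ≤ n) {a : ℕ} (ha : 2 ≤ a)
    (hpos : ∀ l ∈ Set.Icc 2 (n / 2), 0 < modeRoot (l : ZMod n) ↔ a ≤ l) :
    (degeneracyValues n).encard = ((n / 2 + 1 - a : ℕ) : ℕ∞) := by
  rw [degeneracyValues_eq_union (by omega) ha hpos,
    setOf_firstModeDet_eq_zero_of_slope_pos (by omega) (firstModeSlope_pos hn), Set.empty_union,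
    encard_modeRoot_image (by omega)]

theorem modeRoot_three_eq_of_six : modeRoot (3 : ZMod 6) = thirdModeForm 6 / 6 := by
  have hreflect : ringSum (4 : ZMod 6) = ringSum (2 : ZMod 6) := ringSum_neg 2
  rw [modeRoot_three_eq (by norm_num), hreflect, sub_self, zero_div, zero_pow two_ne_zero,
    zero_div, add_zero]

theorem firstModeDet_modeRoot_three_pos : 0 < firstModeDet 6 (modeRoot (3 : ZMod 6)) := by
  have hS : 1.827 ≤ ringSum (1 : ZMod 6) := ringSumLower_le.trans' <| by
    norm_num [ringSumLower, Finset.sum_range_succ, sinUpper_eq]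
  have hS' : ringSum (1 : ZMod 6) ≤ 1.828 := ringSum_one_le_ringSumUpper.trans <| by
    norm_num [ringSumUpper, Finset.sum_range_succ, sinLower_eq]
  obtain ⟨hcot0, hcot0'⟩ : Real.cot (halfAngle 6 0) ∈ Set.Icc 3.731 3.733 :=
    Set.Icc_subset_Icc (by norm_num [cotLower, sinLower_eq, sinUpper_eq])
      (by norm_num [cotUpper, sinLower_eq, sinUpper_eq]) (cot_halfAngle_mem_Icc (by norm_num))
  have hcot1 : 0.999 ≤ Real.cot (halfAngle 6 1) :=
    (cot_halfAngle_mem_Icc (by norm_num)).1.trans' <| by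
      norm_num [cotLower, sinLower_eq, sinUpper_eq]
  have hcot2 : Real.cot (halfAngle 6 2) ≤ 0.268 :=
    (cot_halfAngle_mem_Icc (by norm_num)).2.trans <| by
      norm_num [cotUpper, sinLower_eq, sinUpper_eq]
  have hroot : modeRoot (3 : ZMod 6) < 1 := by
    rw [modeRoot_three_eq_of_six, thirdModeForm]
    linarith
  have hslope : -2 < firstModeSlope 6 := by
    rw [firstModeSlope]
    push_cast
    linarith
  have hconst : 2 < firstModeConst 6 := by
    rw [firstModeConst]
    push_cast
    nlinarith
  have hpos : 0 < modeRoot (3 : ZMod 6) :=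
    modeRoot_three_pos le_rfl (thirdModeForm_pos le_rfl (by norm_num))
  have hmul : -2 < firstModeSlope 6 * modeRoot (3 : ZMod 6) := by nlinarith
  rw [firstModeDet_eq]
  linarith

end Counting

theorem encard_degeneracyValues_of_le_six {n : ℕ} (h3 : 3 ≤ n) (h6 : n ≤ 6) :
    (degeneracyValues n).encard = ((n / 2 - 2 : ℕ) : ℕ∞) + 1 := by
  have : NeZero n := ⟨by omega⟩
  have hdisj : Disjoint {m | 0 < m ∧ firstModeDet n m = 0}
      ((fun l : ℕ => modeRoot (l : ZMod n)) '' Set.Icc 3 (n / 2)) := by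
    refine Set.disjoint_left.2 ?_
    rintro m ⟨-, hdet⟩ ⟨l, ⟨hl3, hl⟩, rfl⟩
    obtain rfl : n = 6 := by omega
    obtain rfl : l = 3 := by omega
    exact firstModeDet_modeRoot_three_pos.ne' hdet
  rw [degeneracyValues_eq_union h3 (by norm_num) fun l => modeRoot_pos_iff_three_le (by omega),
    Set.encard_union_eq hdisj, encard_modeRoot_image (by norm_num),
    setOf_firstModeDet_eq_zero_of_slope_neg (by omega) (firstModeSlope_neg h3 h6),
    Set.encard_singleton, add_comm]
  congr 1

theorem encard_degeneracyValues_of_le_nine {n : ℕ} (h7 : 7 ≤ n) (h9 : n ≤ 9) :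
    (degeneracyValues n).encard = ((n / 2 - 2 : ℕ) : ℕ∞) :=
  have : NeZero n := ⟨by omega⟩
  encard_degeneracyValues_of_modeRoot_pos_iff h7 (a := 3) (by norm_num) fun _ =>
    modeRoot_pos_iff_three_le h9

theorem encard_degeneracyValues_of_ten_le {n : ℕ} (hn : 10 ≤ n) :
    (degeneracyValues n).encard = ((n / 2 - 1 : ℕ) : ℕ∞) :=
  have : NeZero n := ⟨by omega⟩
  encard_degeneracyValues_of_modeRoot_pos_iff (by omega) (a := 2) le_rfl fun _ hl =>
    iff_of_true (modeRoot_pos hn hl) hl.1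

theorem encard_degeneracyValues_of_seven_le {n : ℕ} (hn : 7 ≤ n) :
    (degeneracyValues n).encard = ((if n ≤ 9 then n / 2 - 2 else n / 2 - 1 : ℕ) : ℕ∞) := by
  split_ifs with h9
  · exact encard_degeneracyValues_of_le_nine hn h9
  · exact encard_degeneracyValues_of_ten_le (by omega)

theorem mainTheorem5 :
    (degeneracyValues 3).encard = 1 ∧
    (∀ n : ℕ, 4 ≤ n → n ≤ 6 → (degeneracyValues n).encard = ((n / 2 - 1 : ℕ) : ℕ∞)) ∧
    (∀ n : ℕ, 7 ≤ n → n ≤ 9 → (degeneracyValues n).encard = ((n / 2 - 2 : ℕ) : ℕ∞)) ∧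
    (∀ n : ℕ, 10 ≤ n → (degeneracyValues n).encard = ((n / 2 - 1 : ℕ) : ℕ∞)) ∧
    (∀ n : ℕ, 7 ≤ n →
      (degeneracyValues n).encard ≤ (degeneracyValues (n + 1)).encard ∧
      (degeneracyValues n).encard < (degeneracyValues (n + 2)).encard) := by
  refine ⟨?_, fun n h4 h6 => ?_, fun n => encard_degeneracyValues_of_le_nine,
    fun n => encard_degeneracyValues_of_ten_le, fun n h7 => ?_⟩
  · rw [encard_degeneracyValues_of_le_six le_rfl (by norm_num)]
    norm_num
  · rw [encard_degeneracyValues_of_le_six (by omega) h6, ← Nat.cast_add_one]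
    congr 1
    omega
  · rw [encard_degeneracyValues_of_seven_le h7,
      encard_degeneracyValues_of_seven_le (by omega : 7 ≤ n + 1),
      encard_degeneracyValues_of_seven_le (by omega : 7 ≤ n + 2), Nat.cast_le, Nat.cast_lt]
    constructor <;> split_ifs <;> omega
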